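/- There are a deterministic algorithm, a polynomial $p$ and an absolute constant $c>0$ such that the following holds. Let $f_1,\dots,f_n$ be closed axis-aligned boxes in the plane, $f_i=[l_i,r_i]\times[b_i,t_i]$ with real coordinates $l_i\le r_i$ and $b_i\le t_i$, and let $w_1,\dots,w_n>0$ be real weights. Call $J\subseteq\{1,\dots,n\}$ independent if $f_i\cap f_j=\emptyset$ for all distinct $i,j\in J$, and let $\mathrm{opt}$ be the maximum of $\sum_{i\in J}w_i$ over all independent sets $J$. Given the numbers $n,l_i,r_i,b_i,t_i,w_i$, the algorithm halts after at most $p(n)$ steps and outputs an independent set $J$; moreover, if $n\ge 3$, then $$\sum_{i\in J}w_i\ \ge\ c\cdot\frac{\log\log n}{\log n}\cdot\mathrm{opt}.$$ Here an algorithm is a program, independent of $n$, for a real random access machine that has arrays of natural numbers and arrays of real numbers with indirect addressing by natural numbers, whose operations on reals are addition, subtraction and comparison, whose operations on natural numbers are addition, truncated subtraction, halving and comparison, and whose only constants are natural numbers; each executed assignment and each evaluated test counts as one step. -/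

import Mathlib

/-! ## Weighted axis-aligned boxes -/

/-- A closed axis-aligned box `[left, right] × [bottom, top]` in the plane, with a positive
weight. -/
structure WeightedBox where
  left : ℝ
  right : ℝ
  bottom : ℝ
  top : ℝ
  weight : ℝ
  left_le_right : left ≤ right
  bottom_le_top : bottom ≤ top
  weight_pos : 0 < weight

namespace WeightedBox

/-- The set of points of the plane that the box occupies. -/
def region (b : WeightedBox) : Set (ℝ × ℝ) :=
  Set.Icc b.left b.right ×ˢ Set.Icc b.bottom b.top

/-- A set of (indices of) boxes is independent if no two of the boxes intersect. -/
def IsIndependent {n : ℕ} (B : Fin n → WeightedBox) (J : Finset (Fin n)) : Prop :=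
  ∀ i ∈ J, ∀ j ∈ J, i ≠ j → (B i).region ∩ (B j).region = ∅

/-- The total weight of a set of boxes. -/
noncomputable def totalWeight {n : ℕ} (B : Fin n → WeightedBox) (J : Finset (Fin n)) : ℝ :=
  ∑ i ∈ J, (B i).weight

/-- The maximum total weight of an independent set (see `isGreatest_opt`). -/
noncomputable def opt {n : ℕ} (B : Fin n → WeightedBox) : ℝ :=
  sSup (totalWeight B '' {J | IsIndependent B J})

theorem isGreatest_opt {n : ℕ} (B : Fin n → WeightedBox) :
    IsGreatest (totalWeight B '' {J | IsIndependent B J}) (opt B) := by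
  have hfin : (totalWeight B '' {J | IsIndependent B J}).Finite := Set.toFinite _
  have hne : (totalWeight B '' {J | IsIndependent B J}).Nonempty :=
    ⟨_, ∅, by simp [IsIndependent], rfl⟩
  exact ⟨hne.csSup_mem hfin, fun _ h => le_csSup hfin.bddAbove h⟩

end WeightedBox

/-! ## A real random access machine

The memory consists of arrays of natural numbers and arrays of real numbers, each with cells
indexed by `ℕ`; a program names finitely many arrays, and addresses cells by computed indices.
The arithmetic on real numbers is addition and subtraction only, the arithmetic on natural
numbers is addition, truncated subtraction and halving, the only constants are natural numbers,
and real numbers can otherwise only be compared. There is no multiplication, no rounding and no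
conversion from reals to naturals, so in `t` steps a fixed program lengthens the numbers in
memory by only `O(t)` bits, and charging one unit per step is fair also in the bit model. -/

namespace RealRAM

/-- The memory: `nat a i` and `real a i` are cell `i` of the natural, respectively real,
array `a`. -/
structure State where
  nat : ℕ → ℕ → ℕ
  real : ℕ → ℕ → ℝ

/-- Expressions with natural number values. -/
inductive NatExpr where
  | lit (k : ℕ)
  | get (a : ℕ) (i : NatExpr)
  | add (e f : NatExpr)
  | sub (e f : NatExpr)
  | half (e : NatExpr)

/-- Expressions with real values. -/
inductive RealExpr where
  | lit (k : ℕ)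
  | get (a : ℕ) (i : NatExpr)
  | add (e f : RealExpr)
  | sub (e f : RealExpr)

/-- Tests that govern branching. -/
inductive Test where
  | natLt (e f : NatExpr)
  | realLt (e f : RealExpr)
  | neg (b : Test)
  | conj (b c : Test)

/-- Programs. -/
inductive Program where
  | skip
  | setNat (a : ℕ) (i : NatExpr) (e : NatExpr)
  | setReal (a : ℕ) (i : NatExpr) (e : RealExpr)
  | seq (P Q : Program)
  | branch (b : Test) (P Q : Program)
  | loop (b : Test) (P : Program)

def NatExpr.eval (s : State) : NatExpr → ℕ
  | .lit k => k
  | .get a i => s.nat a (i.eval s)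
  | .add e f => e.eval s + f.eval s
  | .sub e f => e.eval s - f.eval s
  | .half e => e.eval s / 2

noncomputable def RealExpr.eval (s : State) : RealExpr → ℝ
  | .lit k => (k : ℝ)
  | .get a i => s.real a (i.eval s)
  | .add e f => e.eval s + f.eval s
  | .sub e f => e.eval s - f.eval s

def Test.Holds (s : State) : Test → Prop
  | .natLt e f => e.eval s < f.eval s
  | .realLt e f => e.eval s < f.eval s
  | .neg b => ¬ b.Holds s
  | .conj b c => b.Holds s ∧ c.Holds s

/-- Write `v` into cell `i` of the natural array `a`. -/
def State.writeNat (s : State) (a i v : ℕ) : State :=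
  { s with nat := Function.update s.nat a (Function.update (s.nat a) i v) }

/-- Write `v` into cell `i` of the real array `a`. -/
def State.writeReal (s : State) (a i : ℕ) (v : ℝ) : State :=
  { s with real := Function.update s.real a (Function.update (s.real a) i v) }

/-- `Exec P s t s'`: started in memory state `s`, the program `P` halts after `t` steps in state
`s'`. Every executed assignment (or `skip`) and every evaluated test is one step; expressions and
tests have a fixed size given by the program, so this is the number of elementary operations up
to a factor that depends on the program only. -/
inductive Exec : Program → State → ℕ → State → Prop
  | skip (s : State) : Exec .skip s 1 s
  | setNat (a : ℕ) (i e : NatExpr) (s : State) :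
      Exec (.setNat a i e) s 1 (s.writeNat a (i.eval s) (e.eval s))
  | setReal (a : ℕ) (i : NatExpr) (e : RealExpr) (s : State) :
      Exec (.setReal a i e) s 1 (s.writeReal a (i.eval s) (e.eval s))
  | seq {P Q : Program} {s s' s'' : State} {t t' : ℕ} :
      Exec P s t s' → Exec Q s' t' s'' → Exec (.seq P Q) s (t + t') s''
  | branchTrue {b : Test} {P Q : Program} {s s' : State} {t : ℕ} :
      b.Holds s → Exec P s t s' → Exec (.branch b P Q) s (t + 1) s'
  | branchFalse {b : Test} {P Q : Program} {s s' : State} {t : ℕ} :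
      ¬ b.Holds s → Exec Q s t s' → Exec (.branch b P Q) s (t + 1) s'
  | loopStop {b : Test} {P : Program} {s : State} :
      ¬ b.Holds s → Exec (.loop b P) s 1 s
  | loopStep {b : Test} {P : Program} {s s' s'' : State} {t t' : ℕ} :
      b.Holds s → Exec P s t s' → Exec (.loop b P) s' t' s'' →
        Exec (.loop b P) s (t + t' + 1) s''

/-- The machine is deterministic: final state and number of steps are unique. -/
theorem Exec.unique {P : Program} {s s₁ : State} {t₁ : ℕ} (h₁ : Exec P s t₁ s₁) :
    ∀ {t₂ : ℕ} {s₂ : State}, Exec P s t₂ s₂ → t₁ = t₂ ∧ s₁ = s₂ := by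
  induction h₁ with
  | skip s => intro _ _ h; cases h; exact ⟨rfl, rfl⟩
  | setNat a i e s => intro _ _ h; cases h; exact ⟨rfl, rfl⟩
  | setReal a i e s => intro _ _ h; cases h; exact ⟨rfl, rfl⟩
  | seq _ _ ih ih' =>
    intro _ _ h
    cases h with
    | seq g g' =>
      obtain ⟨rfl, rfl⟩ := ih g
      obtain ⟨rfl, rfl⟩ := ih' g'
      exact ⟨rfl, rfl⟩
  | branchTrue hb _ ih =>
    intro _ _ h
    cases h with
    | branchTrue _ g => obtain ⟨rfl, rfl⟩ := ih g; exact ⟨rfl, rfl⟩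
    | branchFalse hb' _ => exact absurd hb hb'
  | branchFalse hb _ ih =>
    intro _ _ h
    cases h with
    | branchTrue hb' _ => exact absurd hb' hb
    | branchFalse _ g => obtain ⟨rfl, rfl⟩ := ih g; exact ⟨rfl, rfl⟩
  | loopStop hb =>
    intro _ _ h
    cases h with
    | loopStop _ => exact ⟨rfl, rfl⟩
    | loopStep hb' _ _ => exact absurd hb' hb
  | loopStep hb _ _ ih ih' =>
    intro _ _ h
    cases h with
    | loopStop hb' => exact absurd hb hb'
    | loopStep _ g g' =>
      obtain ⟨rfl, rfl⟩ := ih g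
      obtain ⟨rfl, rfl⟩ := ih' g'
      exact ⟨rfl, rfl⟩

/-- The initial memory for the input `B`: cell `0` of the natural array `0` holds the number of
boxes, and cell `i` of the real arrays `0, …, 4` holds the left, right, bottom and top coordinate
and the weight of the `i`-th box. All other cells hold `0`. -/
noncomputable def input {n : ℕ} (B : Fin n → WeightedBox) : State where
  nat a i := if a = 0 ∧ i = 0 then n else 0
  real a i :=
    if h : i < n then
      match a with
      | 0 => (B ⟨i, h⟩).left
      | 1 => (B ⟨i, h⟩).right
      | 2 => (B ⟨i, h⟩).bottom
      | 3 => (B ⟨i, h⟩).top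
      | 4 => (B ⟨i, h⟩).weight
      | _ => 0
    else 0

/-- The output that is read off the final memory: the set of all `i < n` such that cell `i` of
the natural array `1` is nonzero. -/
def output (n : ℕ) (s : State) : Finset (Fin n) :=
  {i | s.nat 1 i ≠ 0}

end RealRAM

/-! ## Programs for bounded arithmetic

Natural array `2` and real array `5` serve as an evaluation stack, and cell `0` of the natural
array `3` holds the common bound of all loops. -/

namespace RealRAM

/-! The algorithm builds a multiset of boxes that is heavy but shallow, splits it into few
independent classes and outputs the heaviest class.

Heavy and shallow: let `ℓ` be least with `n ≤ 2 ^ ℓ`, and `T = 4 * ℓ`. A grid point lying in `m` of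
the boxes picked so far costs `2 ^ m`. Boxes of least price per weight are picked, with repetition,
until the total price reaches `2 ^ T`; then no grid point lies in more than `T` picked boxes
(`IsGreedy.load_le`). The boxes of an optimal solution are disjoint, so their prices add up to at
most the total price, and picking a box of weight `w` multiplies the total by at most `exp (w /
opt)`. Growth from at most `n ^ 2` to `2 ^ T` forces the picked weight to be at least `ℓ * opt`
(`IsGreedy.le_listWeight`). This takes the place of a linear program.

Colours: if two boxes intersect without crossing, one contains a corner of the other. Hence depth
`T` implies that every submultiset has a member with at most `8 * T` conflicts
(`exists_few_conflicts`). Removing such members one by one and reversing the order leaves each box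
with at most `8 * T` earlier conflicts, so at least `8 * T + 1` of `16 * T + 1` colours are
admissible for it. A random admissible colour would spread the boxes evenly; an exponential
potential, kept from increasing, makes the choice deterministic (`IsColoring.col_spec`). It yields
`(8 * T + 1) ^ D ≤ n ^ 2 * 2 ^ T * (16 * T + 1)` for the depth `D` within one colour
(`IsColoring.pow_colorLoad_le`), that is, `D = O(log n / log log n)`.

Levels: boxes of one colour intersect only if one crosses the other vertically, which is a strict
partial order. Levels below `D` that increase along it separate such boxes (`IsColoring.not_meets`).
The `(16 * T + 1) * D` classes by colour and level share the weight `ℓ * opt`, and `T = 4 * ℓ`, so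
the heaviest has weight of order `opt / D`.

Machine: every quantity is expressed by sums, tests and searches over indices below one bound `(n +
2) ^ 8`, and closure lemmas turn these expressions into polynomial-time programs. Each array is
filled by a rule that reads finished arrays and its own earlier cells, so the final memory satisfies
all the defining equations (`solved_stages`). The combinatorics uses only these equations
(`exists_class`). -/

@[simp] theorem State.writeNat_nat (s : State) (a i v a' i' : ℕ) :
    (s.writeNat a i v).nat a' i' = if a' = a ∧ i' = i then v else s.nat a' i' := by
  unfold State.writeNat
  by_cases h : a' = a
  · subst h
    by_cases h' : i' = i
    · subst h'; simp
    · simp [h']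
  · simp [h]

@[simp] theorem State.writeNat_real (s : State) (a i v : ℕ) :
    (s.writeNat a i v).real = s.real := rfl

@[simp] theorem State.writeReal_nat (s : State) (a i : ℕ) (v : ℝ) :
    (s.writeReal a i v).nat = s.nat := rfl

@[simp] theorem State.writeReal_real (s : State) (a i : ℕ) (v : ℝ) (a' i' : ℕ) :
    (s.writeReal a i v).real a' i' = if a' = a ∧ i' = i then v else s.real a' i' := by
  unfold State.writeReal
  by_cases h : a' = a
  · subst h
    by_cases h' : i' = i
    · subst h'; simp
    · simp [h']
  · simp [h]

theorem State.ext_cells {s s' : State} (h : ∀ a i, s.nat a i = s'.nat a i)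
    (hr : ∀ a i, s.real a i = s'.real a i) : s = s' := by
  cases s; cases s'
  simp only [State.mk.injEq]
  exact ⟨funext fun a => funext (h a), funext fun a => funext (hr a)⟩

/-- The memory with the evaluation stacks erased. -/
def State.clean (s : State) : State where
  nat a i := if a = 2 then 0 else s.nat a i
  real a i := if a = 5 then 0 else s.real a i

/-- The common bound of all loops. -/
def State.bound (s : State) : ℕ := s.nat 3 0

@[simp] theorem State.clean_bound (s : State) : s.clean.bound = s.bound := rfl

theorem State.clean_nat (s : State) {a : ℕ} (h : a ≠ 2) (i : ℕ) :
    s.clean.nat a i = s.nat a i := by simp [State.clean, h]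

theorem State.clean_real (s : State) {a : ℕ} (h : a ≠ 5) (i : ℕ) :
    s.clean.real a i = s.real a i := by simp [State.clean, h]

@[simp] theorem State.clean_writeNat_stack (s : State) (i v : ℕ) :
    (s.writeNat 2 i v).clean = s.clean := by
  apply State.ext_cells
  · intro a j; by_cases h : a = 2 <;> simp [State.clean, h]
  · intro a j; rfl

@[simp] theorem State.clean_writeReal_stack (s : State) (i : ℕ) (v : ℝ) :
    (s.writeReal 5 i v).clean = s.clean := by
  apply State.ext_cells
  · intro a j; rfl
  · intro a j; by_cases h : a = 5 <;> simp [State.clean, h]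

theorem State.clean_writeNat (s : State) {a : ℕ} (h : a ≠ 2) (i v : ℕ) :
    (s.writeNat a i v).clean = s.clean.writeNat a i v := by
  apply State.ext_cells
  · intro a' j
    by_cases h' : a' = 2
    · subst h'; simp [State.clean, h.symm]
    · simp [State.clean, h']
  · intro a j; rfl

/-- `Agree e s s'`: the states differ at most in the stack cells with index `e` or more. -/
structure Agree (e : ℕ) (s s' : State) : Prop where
  clean : s'.clean = s.clean
  nat : ∀ i < e, s'.nat 2 i = s.nat 2 i
  real : ∀ i < e, s'.real 5 i = s.real 5 i

namespace Agree

theorem trans {e : ℕ} {s s' s'' : State} (h : Agree e s s') (h' : Agree e s' s'') :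
    Agree e s s'' :=
  ⟨h'.clean.trans h.clean, fun i hi => (h'.nat i hi).trans (h.nat i hi),
    fun i hi => (h'.real i hi).trans (h.real i hi)⟩

theorem mono {e e' : ℕ} {s s' : State} (h : Agree e' s s') (he : e ≤ e') : Agree e s s' :=
  ⟨h.clean, fun i hi => h.nat i (hi.trans_le he), fun i hi => h.real i (hi.trans_le he)⟩

theorem writeNat {e i : ℕ} (s : State) (v : ℕ) (h : e ≤ i) : Agree e s (s.writeNat 2 i v) :=
  ⟨by simp, fun j hj => by simp [(hj.trans_le h).ne], fun _ _ => rfl⟩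

theorem writeReal {e i : ℕ} (s : State) (v : ℝ) (h : e ≤ i) : Agree e s (s.writeReal 5 i v) :=
  ⟨by simp, fun _ _ => rfl, fun j hj => by simp [(hj.trans_le h).ne]⟩

theorem bound {e : ℕ} {s s' : State} (h : Agree e s s') : s'.bound = s.bound := by
  rw [← s'.clean_bound, h.clean, s.clean_bound]

theorem vars {e d : ℕ} {s s' : State} (h : Agree e s s') {loc : Fin d → ℕ}
    (hl : ∀ i, loc i < e) : (fun i => s'.nat 2 (loc i)) = fun i => s.nat 2 (loc i) :=
  funext fun i => h.nat _ (hl i)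

end Agree

/-- A value that depends on the memory and on `d` natural variables can be computed: for every
placement of the variables below the stack cell `e`, some program puts it into the stack cell `e`
without touching the cells below, in time polynomial in the loop bound. -/
def NatComputable {d : ℕ} (f : State → (Fin d → ℕ) → ℕ) : Prop :=
  ∀ (loc : Fin d → ℕ) (e : ℕ), (∀ i, loc i < e) →
    ∃ (P : Program) (p : Polynomial ℕ), ∀ s : State, ∃ t s', Exec P s t s' ∧
      t ≤ p.eval s.bound ∧ Agree e s s' ∧ s'.nat 2 e = f s.clean fun i => s.nat 2 (loc i)

/-- The analogue of `NatComputable` for real values. -/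
def RealComputable {d : ℕ} (f : State → (Fin d → ℕ) → ℝ) : Prop :=
  ∀ (loc : Fin d → ℕ) (e : ℕ), (∀ i, loc i < e) →
    ∃ (P : Program) (p : Polynomial ℕ), ∀ s : State, ∃ t s', Exec P s t s' ∧
      t ≤ p.eval s.bound ∧ Agree e s s' ∧ s'.real 5 e = f s.clean fun i => s.nat 2 (loc i)

open Classical in
/-- A property of the memory and of `d` natural variables can be decided. -/
def Decides {d : ℕ} (q : State → (Fin d → ℕ) → Prop) : Prop :=
  NatComputable fun M v => if q M v then 1 else 0

/-- Loop rule: an invariant that the body propagates, and a bound on the time of the body. -/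
theorem exec_loop {b : Test} {Q : Program} {N τ : ℕ} (I : ℕ → State → Prop)
    (step : ∀ k < N, ∀ s, I k s →
      b.Holds s ∧ ∃ t s', Exec Q s t s' ∧ t ≤ τ ∧ I (k + 1) s')
    (final : ∀ s, I N s → ¬ b.Holds s) {s : State} (h : I 0 s) :
    ∃ t s', Exec (.loop b Q) s t s' ∧ t ≤ N * (τ + 1) + 1 ∧ I N s' := by
  have key : ∀ m k, k + m = N → ∀ s, I k s →
      ∃ t s', Exec (.loop b Q) s t s' ∧ t ≤ m * (τ + 1) + 1 ∧ I N s' := by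
    intro m
    induction m with
    | zero =>
      intro k hk s hs
      obtain rfl : k = N := by omega
      exact ⟨1, s, .loopStop (final s hs), by omega, hs⟩
    | succ m ih =>
      intro k hk s hs
      obtain ⟨hb, t, s', hx, ht, hs'⟩ := step k (by omega) s hs
      obtain ⟨t', s'', hx', ht', hs''⟩ := ih (k + 1) (by omega) s' hs'
      refine ⟨_, s'', .loopStep hb hx hx', ?_, hs''⟩
      rw [Nat.succ_mul]; omega
  exact key N 0 (by omega) s h

/-! ### Closure properties of computable natural values -/

namespace NatComputable

variable {d : ℕ}

theorem lit (c : ℕ) : NatComputable (d := d) fun _ _ => c := fun _ e _ =>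
  ⟨.setNat 2 (.lit e) (.lit c), 1, fun s => ⟨_, _, .setNat _ _ _ s, by simp,
    Agree.writeNat s _ le_rfl, by simp [NatExpr.eval]⟩⟩

theorem var (i : Fin d) : NatComputable fun _ v => v i := fun loc e _ =>
  ⟨.setNat 2 (.lit e) (.get 2 (.lit (loc i))), 1, fun s => ⟨_, _, .setNat _ _ _ s, by simp,
    Agree.writeNat s _ le_rfl, by simp [NatExpr.eval]⟩⟩

/-- Computability allows every placement of the variables in memory, so an additional variable is
dropped by forgetting its cell. -/
theorem weaken {f : State → (Fin d → ℕ) → ℕ} (hf : NatComputable f) :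
    NatComputable fun M (v : Fin (d + 1) → ℕ) => f M fun i => v i.castSucc :=
  fun loc e hl => hf (fun i => loc i.castSucc) e fun _ => hl _

theorem get (a : ℕ) (ha : a ≠ 2) {f : State → (Fin d → ℕ) → ℕ} (hf : NatComputable f) :
    NatComputable fun M v => M.nat a (f M v) := by
  intro loc e hl
  obtain ⟨P, p, hP⟩ := hf loc e hl
  refine ⟨.seq P (.setNat 2 (.lit e) (.get a (.get 2 (.lit e)))), p + 1, fun s => ?_⟩
  obtain ⟨t, s', hx, ht, hA, hv⟩ := hP s
  refine ⟨_, _, .seq hx (.setNat _ _ _ s'), by simp [ht],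
    hA.trans (Agree.writeNat s' _ le_rfl), ?_⟩
  simp only [NatExpr.eval, State.writeNat_nat, and_self, if_true, hv]
  rw [← s'.clean_nat ha, hA.clean]

/-- Binary operations that the machine offers. -/
theorem binary {f g : State → (Fin d → ℕ) → ℕ} (hf : NatComputable f) (hg : NatComputable g)
    (E : NatExpr → NatExpr → NatExpr) (o : ℕ → ℕ → ℕ)
    (hE : ∀ s x y, (E x y).eval s = o (x.eval s) (y.eval s)) :
    NatComputable fun M v => o (f M v) (g M v) := by
  intro loc e hl
  obtain ⟨P, p, hP⟩ := hf loc e hl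
  obtain ⟨Q, q, hQ⟩ := hg loc (e + 1) fun i => (hl i).trans (Nat.lt_succ_self e)
  refine ⟨.seq P (.seq Q (.setNat 2 (.lit e) (E (.get 2 (.lit e)) (.get 2 (.lit (e + 1)))))),
    p + (q + 1), fun s => ?_⟩
  obtain ⟨t, s', hx, ht, hA, hv⟩ := hP s
  obtain ⟨t', s'', hx', ht', hA', hv'⟩ := hQ s'
  rw [hA.bound] at ht'
  refine ⟨_, _, .seq hx (.seq hx' (.setNat _ _ _ s'')), ?_,
    (hA.trans (hA'.mono e.le_succ)).trans (Agree.writeNat s'' _ le_rfl), ?_⟩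
  · simp only [Polynomial.eval_add, Polynomial.eval_one]; omega
  · simp only [NatExpr.eval, State.writeNat_nat, and_self, if_true, hE, hv',
      hA'.nat e e.lt_succ_self, hv, hA.clean, hA.vars hl]

theorem add {f g : State → (Fin d → ℕ) → ℕ} (hf : NatComputable f) (hg : NatComputable g) :
    NatComputable fun M v => f M v + g M v :=
  binary hf hg .add (· + ·) fun _ _ _ => rfl

theorem sub {f g : State → (Fin d → ℕ) → ℕ} (hf : NatComputable f) (hg : NatComputable g) :
    NatComputable fun M v => f M v - g M v :=
  binary hf hg .sub (· - ·) fun _ _ _ => rfl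

theorem ite {q : State → (Fin d → ℕ) → Prop} [∀ M v, Decidable (q M v)]
    {f g : State → (Fin d → ℕ) → ℕ} (hq : Decides q)
    (hf : NatComputable f) (hg : NatComputable g) :
    NatComputable fun M v => if q M v then f M v else g M v := by
  intro loc e hl
  obtain ⟨P, p, hP⟩ := hq loc e hl
  obtain ⟨Q, q', hQ⟩ := hf loc e hl
  obtain ⟨R, r, hR⟩ := hg loc e hl
  refine ⟨.seq P (.branch (.natLt (.lit 0) (.get 2 (.lit e))) Q R), p + (q' + r + 1),
    fun s => ?_⟩
  obtain ⟨t, s', hx, ht, hA, hv⟩ := hP s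
  by_cases hc : q s.clean fun i => s.nat 2 (loc i)
  · obtain ⟨t', s'', hx', ht', hA', hv'⟩ := hQ s'
    rw [hA.bound] at ht'
    refine ⟨_, _, .seq hx (.branchTrue ?_ hx'), ?_, hA.trans hA', ?_⟩
    · simp [Test.Holds, NatExpr.eval, hv, hc]
    · simp only [Polynomial.eval_add, Polynomial.eval_one]; omega
    · rw [hv', hA.clean, hA.vars hl]; exact (if_pos hc).symm
  · obtain ⟨t', s'', hx', ht', hA', hv'⟩ := hR s'
    rw [hA.bound] at ht'
    refine ⟨_, _, .seq hx (.branchFalse ?_ hx'), ?_, hA.trans hA', ?_⟩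
    · simp [Test.Holds, NatExpr.eval, hv, hc]
    · simp only [Polynomial.eval_add, Polynomial.eval_one]; omega
    · rw [hv', hA.clean, hA.vars hl]; exact (if_neg hc).symm

/-- Cell `e` accumulates the sum, cell `e + 1` counts and serves as the new variable of the summand,
which is evaluated from cell `e + 2` on and so leaves both intact. -/
theorem sum {f : State → (Fin d → ℕ) → ℕ → ℕ}
    (hf : NatComputable fun M (v : Fin (d + 1) → ℕ) =>
      f M (fun i => v i.castSucc) (v (Fin.last d))) :
    NatComputable fun M v => ∑ x ∈ Finset.range M.bound, f M v x := by
  intro loc e hl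
  obtain ⟨P, p, hP⟩ := hf (Fin.snoc (α := fun _ => ℕ) loc (e + 1)) (e + 2) (by
    intro i
    refine Fin.lastCases ?_ (fun i => ?_) i
    · simp
    · simpa using (hl i).trans_le (by omega))
  refine ⟨.seq (.setNat 2 (.lit e) (.lit 0)) (.seq (.setNat 2 (.lit (e + 1)) (.lit 0))
    (.loop (.natLt (.get 2 (.lit (e + 1))) (.get 3 (.lit 0)))
      (.seq P (.seq (.setNat 2 (.lit e) (.add (.get 2 (.lit e)) (.get 2 (.lit (e + 2)))))
        (.setNat 2 (.lit (e + 1)) (.add (.get 2 (.lit (e + 1))) (.lit 1))))))),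
    1 + (1 + (Polynomial.X * (p + (1 + 1) + 1) + 1)), fun s => ?_⟩
  set s₁ := s.writeNat 2 e 0 with hs₁
  set s₂ := s₁.writeNat 2 (e + 1) 0 with hs₂
  obtain ⟨t, s', hx, ht, hA, hv, -⟩ := exec_loop (N := s.bound) (τ := p.eval s.bound + (1 + 1))
    (b := .natLt (.get 2 (.lit (e + 1))) (.get 3 (.lit 0)))
    (Q := .seq P (.seq (.setNat 2 (.lit e) (.add (.get 2 (.lit e)) (.get 2 (.lit (e + 2)))))
        (.setNat 2 (.lit (e + 1)) (.add (.get 2 (.lit (e + 1))) (.lit 1)))))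
    (fun k s' => Agree e s s' ∧
      s'.nat 2 e = ∑ x ∈ Finset.range k, f s.clean (fun i => s.nat 2 (loc i)) x ∧
      s'.nat 2 (e + 1) = k)
    (by
      rintro k hk s' ⟨hA, hv, hi⟩
      refine ⟨?_, ?_⟩
      · simpa [Test.Holds, NatExpr.eval, hi, ← hA.bound, State.bound] using
          (hk.trans_eq hA.bound.symm)
      obtain ⟨t, s'', hx, ht, hA', hv'⟩ := hP s'
      rw [hA.bound] at ht
      refine ⟨_, _, .seq hx (.seq (.setNat _ _ _ _) (.setNat _ _ _ _)), by omega,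
        ((hA.trans (hA'.mono (by omega))).trans (Agree.writeNat _ _ le_rfl)).trans
          (Agree.writeNat _ _ (by simp [NatExpr.eval])), ?_, ?_⟩
      · simp only [NatExpr.eval, State.writeNat_nat]
        rw [if_neg (by omega), if_pos (by simp), Finset.sum_range_succ, hA'.nat e (by omega), hv,
          hv']
        simp only [Fin.snoc_castSucc, Fin.snoc_last, hA.clean, hA.vars hl, hi]
      · simp [NatExpr.eval, hA'.nat (e + 1) (by omega), hi])
    (by
      rintro s' ⟨hA, hv, hi⟩
      simp only [Test.Holds, NatExpr.eval, hi, not_lt]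
      exact hA.bound.le)
    (s := s₂) ⟨(Agree.writeNat s 0 le_rfl).trans (Agree.writeNat s₁ 0 (by omega)), by
      simp [s₂, s₁], by simp [s₂]⟩
  refine ⟨_, _, .seq (.setNat _ _ _ _) (.seq (.setNat _ _ _ _) hx), ?_, hA, ?_⟩
  · simp only [Polynomial.eval_add, Polynomial.eval_one, Polynomial.eval_mul, Polynomial.eval_X]
    omega
  · rw [hv]; rfl

end NatComputable

/-! ### Closure properties of computable real values -/

namespace RealComputable

variable {d : ℕ}

theorem lit (c : ℕ) : RealComputable (d := d) fun _ _ => (c : ℝ) := fun _ e _ =>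
  ⟨.setReal 5 (.lit e) (.lit c), 1, fun s => ⟨_, _, .setReal _ _ _ s, by simp,
    Agree.writeReal s _ le_rfl, by simp [NatExpr.eval, RealExpr.eval]⟩⟩

theorem zero : RealComputable (d := d) fun _ _ => 0 := by
  simpa using RealComputable.lit (d := d) 0

theorem get (a : ℕ) (ha : a ≠ 5) {f : State → (Fin d → ℕ) → ℕ} (hf : NatComputable f) :
    RealComputable fun M v => M.real a (f M v) := by
  intro loc e hl
  obtain ⟨P, p, hP⟩ := hf loc e hl
  refine ⟨.seq P (.setReal 5 (.lit e) (.get a (.get 2 (.lit e)))), p + 1, fun s => ?_⟩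
  obtain ⟨t, s', hx, ht, hA, hv⟩ := hP s
  refine ⟨_, _, .seq hx (.setReal _ _ _ s'), by simp [ht],
    hA.trans (Agree.writeReal s' _ le_rfl), ?_⟩
  simp only [NatExpr.eval, RealExpr.eval, State.writeReal_real, and_self, if_true, hv]
  rw [← s'.clean_real ha, hA.clean]

theorem ite {q : State → (Fin d → ℕ) → Prop} [∀ M v, Decidable (q M v)]
    {f g : State → (Fin d → ℕ) → ℝ} (hq : Decides q)
    (hf : RealComputable f) (hg : RealComputable g) :
    RealComputable fun M v => if q M v then f M v else g M v := by
  intro loc e hl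
  obtain ⟨P, p, hP⟩ := hq loc e hl
  obtain ⟨Q, q', hQ⟩ := hf loc e hl
  obtain ⟨R, r, hR⟩ := hg loc e hl
  refine ⟨.seq P (.branch (.natLt (.lit 0) (.get 2 (.lit e))) Q R), p + (q' + r + 1),
    fun s => ?_⟩
  obtain ⟨t, s', hx, ht, hA, hv⟩ := hP s
  by_cases hc : q s.clean fun i => s.nat 2 (loc i)
  · obtain ⟨t', s'', hx', ht', hA', hv'⟩ := hQ s'
    rw [hA.bound] at ht'
    refine ⟨_, _, .seq hx (.branchTrue ?_ hx'), ?_, hA.trans hA', ?_⟩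
    · simp [Test.Holds, NatExpr.eval, hv, hc]
    · simp only [Polynomial.eval_add, Polynomial.eval_one]; omega
    · rw [hv', hA.clean, hA.vars hl]; exact (if_pos hc).symm
  · obtain ⟨t', s'', hx', ht', hA', hv'⟩ := hR s'
    rw [hA.bound] at ht'
    refine ⟨_, _, .seq hx (.branchFalse ?_ hx'), ?_, hA.trans hA', ?_⟩
    · simp [Test.Holds, NatExpr.eval, hv, hc]
    · simp only [Polynomial.eval_add, Polynomial.eval_one]; omega
    · rw [hv', hA.clean, hA.vars hl]; exact (if_neg hc).symm

/-- The real accumulator and the natural counter lie on different stacks, so both may use index `e`.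
-/
theorem sum {f : State → (Fin d → ℕ) → ℕ → ℝ}
    (hf : RealComputable fun M (v : Fin (d + 1) → ℕ) =>
      f M (fun i => v i.castSucc) (v (Fin.last d))) :
    RealComputable fun M v => ∑ x ∈ Finset.range M.bound, f M v x := by
  intro loc e hl
  obtain ⟨P, p, hP⟩ := hf (Fin.snoc (α := fun _ => ℕ) loc e) (e + 1) (by
    intro i
    refine Fin.lastCases ?_ (fun i => ?_) i
    · simp
    · rw [Fin.snoc_castSucc]; exact (hl i).trans e.lt_succ_self)
  refine ⟨.seq (.setReal 5 (.lit e) (.lit 0)) (.seq (.setNat 2 (.lit e) (.lit 0))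
    (.loop (.natLt (.get 2 (.lit e)) (.get 3 (.lit 0)))
      (.seq P (.seq (.setReal 5 (.lit e) (.add (.get 5 (.lit e)) (.get 5 (.lit (e + 1)))))
        (.setNat 2 (.lit e) (.add (.get 2 (.lit e)) (.lit 1))))))),
    1 + (1 + (Polynomial.X * (p + (1 + 1) + 1) + 1)), fun s => ?_⟩
  set s₁ := s.writeReal 5 e ((0 : ℕ) : ℝ) with hs₁
  set s₂ := s₁.writeNat 2 e 0 with hs₂
  obtain ⟨t, s', hx, ht, hA, hv, -⟩ := exec_loop (N := s.bound) (τ := p.eval s.bound + (1 + 1))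
    (b := .natLt (.get 2 (.lit e)) (.get 3 (.lit 0)))
    (Q := .seq P (.seq (.setReal 5 (.lit e) (.add (.get 5 (.lit e)) (.get 5 (.lit (e + 1)))))
        (.setNat 2 (.lit e) (.add (.get 2 (.lit e)) (.lit 1)))))
    (fun k s' => Agree e s s' ∧
      s'.real 5 e = ∑ x ∈ Finset.range k, f s.clean (fun i => s.nat 2 (loc i)) x ∧
      s'.nat 2 e = k)
    (by
      rintro k hk s' ⟨hA, hv, hi⟩
      refine ⟨?_, ?_⟩
      · simpa [Test.Holds, NatExpr.eval, hi, ← hA.bound, State.bound] using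
          (hk.trans_eq hA.bound.symm)
      obtain ⟨t, s'', hx, ht, hA', hv'⟩ := hP s'
      rw [hA.bound] at ht
      refine ⟨_, _, .seq hx (.seq (.setReal _ _ _ _) (.setNat _ _ _ _)), by omega,
        ((hA.trans (hA'.mono (by omega))).trans (Agree.writeReal _ _ le_rfl)).trans
          (Agree.writeNat _ _ (by simp [NatExpr.eval])), ?_, ?_⟩
      · simp only [NatExpr.eval, RealExpr.eval, State.writeNat_real, State.writeReal_real]
        rw [if_pos (by simp), Finset.sum_range_succ, hA'.real e (by omega), hv, hv']
        simp only [Fin.snoc_castSucc, Fin.snoc_last, hA.clean, hA.vars hl, hi]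
      · simp [NatExpr.eval, hA'.nat e (by omega), hi])
    (by
      rintro s' ⟨hA, hv, hi⟩
      simp only [Test.Holds, NatExpr.eval, hi, not_lt]
      exact hA.bound.le)
    (s := s₂) ⟨(Agree.writeReal s _ le_rfl).trans (Agree.writeNat s₁ 0 le_rfl), by
      simp [s₂, s₁], by simp [s₂]⟩
  refine ⟨_, _, .seq (.setReal _ _ _ _) (.seq (.setNat _ _ _ _) hx), ?_, hA, ?_⟩
  · simp only [Polynomial.eval_add, Polynomial.eval_one, Polynomial.eval_mul, Polynomial.eval_X]
    omega
  · rw [hv]; rfl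

end RealComputable

/-! ### Closure properties of decidable conditions -/

namespace Decides

variable {d : ℕ}

theorem lt {f g : State → (Fin d → ℕ) → ℕ} (hf : NatComputable f) (hg : NatComputable g) :
    Decides fun M v => f M v < g M v := by
  -- The truncated difference `g - f` is positive exactly if `f < g`; the map `1 - (1 - ·)` reduces
  -- positive values to `1`.
  have h := (NatComputable.lit (d := d) 1).sub ((NatComputable.lit 1).sub (hg.sub hf))
  have e : (fun M v => 1 - (1 - (g M v - f M v))) =
      fun (M : State) v => if f M v < g M v then 1 else 0 := by
    funext M v; split_ifs <;> omega
  rw [e] at h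
  unfold Decides
  convert h

theorem realLt {f g : State → (Fin d → ℕ) → ℝ} (hf : RealComputable f)
    (hg : RealComputable g) : Decides fun M v => f M v < g M v := by
  intro loc e hl
  obtain ⟨P, p, hP⟩ := hf loc e hl
  obtain ⟨Q, q, hQ⟩ := hg loc (e + 1) fun i => (hl i).trans (Nat.lt_succ_self e)
  refine ⟨.seq P (.seq Q (.branch (.realLt (.get 5 (.lit e)) (.get 5 (.lit (e + 1))))
    (.setNat 2 (.lit e) (.lit 1)) (.setNat 2 (.lit e) (.lit 0)))),
    p + (q + (1 + 1)), fun s => ?_⟩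
  obtain ⟨t, s', hx, ht, hA, hv⟩ := hP s
  obtain ⟨t', s'', hx', ht', hA', hv'⟩ := hQ s'
  rw [hA.bound] at ht'
  rw [hA.clean, hA.vars hl] at hv'
  rw [← hA'.real e e.lt_succ_self] at hv
  have hA'' := hA.trans (hA'.mono e.le_succ)
  by_cases hc : f s.clean (fun i => s.nat 2 (loc i)) < g s.clean (fun i => s.nat 2 (loc i))
  · refine ⟨_, _, .seq hx (.seq hx' (.branchTrue ?_ (.setNat _ _ _ s''))), ?_,
      hA''.trans (Agree.writeNat s'' _ le_rfl), ?_⟩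
    · simpa [Test.Holds, RealExpr.eval, NatExpr.eval, hv, hv'] using hc
    · simp only [Polynomial.eval_add, Polynomial.eval_one]; omega
    · simp [NatExpr.eval, hc]
  · refine ⟨_, _, .seq hx (.seq hx' (.branchFalse ?_ (.setNat _ _ _ s''))), ?_,
      hA''.trans (Agree.writeNat s'' _ le_rfl), ?_⟩
    · simpa [Test.Holds, RealExpr.eval, NatExpr.eval, hv, hv'] using hc
    · simp only [Polynomial.eval_add, Polynomial.eval_one]; omega
    · simp [NatExpr.eval, hc]

theorem not {q : State → (Fin d → ℕ) → Prop} (hq : Decides q) :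
    Decides fun M v => ¬ q M v := by
  have h := NatComputable.sub (NatComputable.lit 1) hq
  unfold Decides
  convert h using 3
  split_ifs <;> simp_all

theorem and {q r : State → (Fin d → ℕ) → Prop} (hq : Decides q) (hr : Decides r) :
    Decides fun M v => q M v ∧ r M v := by
  classical
  have h := NatComputable.ite hq hr (NatComputable.lit 0)
  unfold Decides
  convert h using 3
  split_ifs <;> simp_all

theorem imp {q r : State → (Fin d → ℕ) → Prop} (hq : Decides q) (hr : Decides r) :
    Decides fun M v => q M v → r M v := by
  have h := (hq.and hr.not).not
  unfold Decides at h ⊢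
  convert h using 4
  tauto

theorem le {f g : State → (Fin d → ℕ) → ℕ} (hf : NatComputable f) (hg : NatComputable g) :
    Decides fun M v => f M v ≤ g M v := by
  simpa only [not_lt] using (lt hg hf).not

theorem realLe {f g : State → (Fin d → ℕ) → ℝ} (hf : RealComputable f)
    (hg : RealComputable g) : Decides fun M v => f M v ≤ g M v := by
  simpa only [not_lt] using (realLt hg hf).not

theorem eq {f g : State → (Fin d → ℕ) → ℕ} (hf : NatComputable f) (hg : NatComputable g) :
    Decides fun M v => f M v = g M v := by
  simpa only [le_antisymm_iff] using (le hf hg).and (le hg hf)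

theorem ne {f g : State → (Fin d → ℕ) → ℕ} (hf : NatComputable f) (hg : NatComputable g) :
    Decides fun M v => f M v ≠ g M v :=
  (eq hf hg).not

theorem all {q : State → (Fin d → ℕ) → ℕ → Prop}
    (hq : Decides fun M (v : Fin (d + 1) → ℕ) => q M (fun i => v i.castSucc) (v (Fin.last d))) :
    Decides fun M v => ∀ x < M.bound, q M v x := by
  classical
  -- A bounded universal statement holds if the number of counterexamples is `0`.
  have h := eq (NatComputable.sum (f := fun M v x => if ¬ q M v x then 1 else 0)
    (NatComputable.ite hq.not (NatComputable.lit 1) (NatComputable.lit 0))) (NatComputable.lit 0)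
  simpa only [Finset.sum_eq_zero_iff, Finset.mem_range, ite_eq_right_iff, one_ne_zero, imp_false,
    not_not] using h

theorem ex {q : State → (Fin d → ℕ) → ℕ → Prop}
    (hq : Decides fun M (v : Fin (d + 1) → ℕ) => q M (fun i => v i.castSucc) (v (Fin.last d))) :
    Decides fun M v => ∃ x < M.bound, q M v x := by
  simpa only [not_forall, not_not, exists_prop] using (all (q := fun M v x => ¬ q M v x) hq.not).not

end Decides

open Classical in
/-- The least `x < L` with property `q`, or `L` if there is none. -/
noncomputable def first (L : ℕ) (q : ℕ → Prop) : ℕ :=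
  ∑ x ∈ Finset.range L, if ∀ y < L, y ≤ x → ¬ q y then 1 else 0

/-- The sum in `first` counts the `x` up to which nothing has the property, and these are exactly
the `x < m`. -/
theorem first_eq {L m : ℕ} {q : ℕ → Prop} (hm : m ≤ L) (h : ∀ y < m, ¬ q y)
    (h' : m < L → q m) : first L q = m := by
  classical
  unfold first
  rw [← Finset.sum_subset (Finset.range_subset_range.2 hm)]
  · rw [Finset.sum_congr rfl (g := fun _ => 1)]
    · simp
    · intro x hx
      rw [if_pos]
      intro y _ hyx
      exact h y (by have := Finset.mem_range.1 hx; omega)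
  · intro x hx hx'
    rw [Finset.mem_range] at hx hx'
    rw [if_neg]
    intro hc
    exact hc m (by omega) (by omega) (h' (by omega))

theorem first_spec {L : ℕ} {q : ℕ → Prop} (h : ∃ x < L, q x) : first L q < L ∧ q (first L q) := by
  classical
  obtain ⟨x, hx, hqx⟩ := h
  have h' : ∃ x, q x := ⟨x, hqx⟩
  have hlt : Nat.find h' < L := (Nat.find_le hqx).trans_lt hx
  rw [first_eq hlt.le (fun y hy => Nat.find_min h' hy) fun _ => Nat.find_spec h']
  exact ⟨hlt, Nat.find_spec h'⟩

theorem first_of_lt {L : ℕ} {q : ℕ → Prop} (h : first L q < L) : q (first L q) := by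
  by_cases h' : ∃ x < L, q x
  · exact (first_spec h').2
  · push Not at h'
    rw [first_eq le_rfl h' (by omega)] at h
    exact absurd h (lt_irrefl _)

theorem first_le {L x : ℕ} {q : ℕ → Prop} (hx : x < L) (h : q x) : first L q ≤ x := by
  classical
  have h' : ∃ x, q x := ⟨x, h⟩
  have hle : Nat.find h' ≤ x := Nat.find_le h
  rwa [first_eq (hle.trans hx.le) (fun y hy => Nat.find_min h' hy) fun _ => Nat.find_spec h']

theorem NatComputable.first {d : ℕ} {q : State → (Fin d → ℕ) → ℕ → Prop}
    (hq : Decides fun M (v : Fin (d + 1) → ℕ) => q M (fun i => v i.castSucc) (v (Fin.last d))) :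
    NatComputable fun M v => first M.bound (q M v) := by
  classical
  unfold RealRAM.first
  refine NatComputable.sum (.ite (Decides.all (q := fun M v y => y ≤ v (Fin.last d) →
    ¬ q M (fun i => v i.castSucc) y) (.imp (.le (.var _) (.var _)) (.not ?_))) (.lit 1) (.lit 0))
  -- Two bound variables `x`, `y` are in scope, but `q` takes only `y`; the cell of `x` is skipped
  -- by choosing another placement.
  intro loc e hl
  exact hq (Fin.snoc (α := fun _ => ℕ) (fun i => loc i.castSucc.castSucc) (loc (Fin.last _))) e
    (by
      intro i
      refine Fin.lastCases ?_ (fun i => ?_) i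
      · simpa using hl _
      · simpa using hl _) |>.imp fun P h => h.imp fun p h s => by simpa using h s

/-- The sum of the `f x` with `x < m`, as far as `x < L`. -/
def clipSum {α : Type*} [AddCommMonoid α] (L m : ℕ) (f : ℕ → α) : α :=
  ∑ x ∈ Finset.range L, if x < m then f x else 0

theorem clipSum_eq {α : Type*} [AddCommMonoid α] {L m : ℕ} (h : m ≤ L) (f : ℕ → α) :
    clipSum L m f = ∑ x ∈ Finset.range m, f x := by
  unfold clipSum
  rw [← Finset.sum_filter]
  congr 1
  ext x
  simp only [Finset.mem_filter, Finset.mem_range]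
  omega

/-- Products are formed by repeated addition, since the machine cannot multiply. They are exact only
while the number of summands is at most the loop bound. -/
theorem clipSum_const {L m : ℕ} (h : m ≤ L) (c : ℕ) : clipSum L m (fun _ => c) = m * c := by
  simp [clipSum_eq h]

theorem clipSum_const_real {L m : ℕ} (h : m ≤ L) (c : ℝ) :
    clipSum L m (fun _ => c) = m * c := by
  simp [clipSum_eq h]

theorem NatComputable.clipSum {d : ℕ} {g : State → (Fin d → ℕ) → ℕ}
    {f : State → (Fin d → ℕ) → ℕ → ℕ} (hg : NatComputable g)
    (hf : NatComputable fun M (v : Fin (d + 1) → ℕ) =>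
      f M (fun i => v i.castSucc) (v (Fin.last d))) :
    NatComputable fun M v => clipSum M.bound (g M v) (f M v) :=
  NatComputable.sum (f := fun M v x => if x < g M v then f M v x else 0)
    (.ite (.lt (.var _) hg.weaken) hf (.lit 0))

theorem RealComputable.clipSum {d : ℕ} {g : State → (Fin d → ℕ) → ℕ}
    {f : State → (Fin d → ℕ) → ℕ → ℝ} (hg : NatComputable g)
    (hf : RealComputable fun M (v : Fin (d + 1) → ℕ) =>
      f M (fun i => v i.castSucc) (v (Fin.last d))) :
    RealComputable fun M v => clipSum M.bound (g M v) (f M v) :=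
  RealComputable.sum (f := fun M v x => if x < g M v then f M v x else 0)
    (.ite (.lt (.var _) hg.weaken) hf .zero)

theorem NatComputable.bound {d : ℕ} : NatComputable (d := d) fun M _ => M.bound :=
  .get 3 (by decide) (.lit 0)

/-! ### Filling arrays -/

/-- Fill the first `m` cells of the array `A` one after the other. -/
def fillTo (A : ℕ) (f : State → ℕ → ℕ) (M : State) : ℕ → State
  | 0 => M
  | k + 1 => (fillTo A f M k).writeNat A k (f (fillTo A f M k) k)

/-- Fill the array `A` up to the loop bound. -/
def fill (A : ℕ) (f : State → ℕ → ℕ) (M : State) : State := fillTo A f M M.bound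

/-- Memory transformations that a program carries out in polynomial time, apart from the
evaluation stacks. -/
def Performs (φ : State → State) : Prop :=
  ∃ (P : Program) (p : Polynomial ℕ), ∀ s : State, ∃ t s', Exec P s t s' ∧
    t ≤ p.eval s.bound ∧ s'.clean = φ s.clean ∧ s'.bound = s.bound

theorem Performs.comp {φ ψ : State → State} (hφ : Performs φ) (hψ : Performs ψ) :
    Performs fun s => ψ (φ s) := by
  obtain ⟨P, p, hP⟩ := hφ
  obtain ⟨Q, q, hQ⟩ := hψ
  refine ⟨.seq P Q, p + q, fun s => ?_⟩
  obtain ⟨t, s', hx, ht, hc, hb⟩ := hP s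
  obtain ⟨t', s'', hx', ht', hc', hb'⟩ := hQ s'
  rw [hb] at ht'
  exact ⟨_, _, .seq hx hx', by simp only [Polynomial.eval_add]; omega, by rw [hc', hc],
    hb'.trans hb⟩

theorem fillTo_nat_of_ne {A a : ℕ} (h : a ≠ A) (f : State → ℕ → ℕ) (M : State) (m : ℕ) :
    (fillTo A f M m).nat a = M.nat a := by
  induction m with
  | zero => rfl
  | succ m ih => funext i; simp [fillTo, h, ih]

theorem fillTo_real (A : ℕ) (f : State → ℕ → ℕ) (M : State) (m : ℕ) :
    (fillTo A f M m).real = M.real := by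
  induction m with
  | zero => rfl
  | succ m ih => simp [fillTo, ih]

theorem fillTo_nat_of_lt {A k m m' : ℕ} (h : k < m) (h' : m ≤ m') (f : State → ℕ → ℕ)
    (M : State) : (fillTo A f M m').nat A k = (fillTo A f M m).nat A k := by
  induction m', h' using Nat.le_induction with
  | base => rfl
  | succ m' hm ih => rw [← ih]; simp only [fillTo, State.writeNat_nat]; rw [if_neg (by omega)]

theorem fillTo_nat_succ (A k : ℕ) (f : State → ℕ → ℕ) (M : State) :
    (fillTo A f M (k + 1)).nat A k = f (fillTo A f M k) k := by
  simp [fillTo]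

/-- A filled array satisfies the defining equation if the equation only looks at the cells filled
before. -/
theorem fill_nat {A k : ℕ} {f : State → ℕ → ℕ} {M : State} (hk : k < M.bound)
    (hf : ∀ M' M'' : State, M'.real = M''.real → (∀ a, a ≠ A → M'.nat a = M''.nat a) →
      (∀ j < k, M'.nat A j = M''.nat A j) → f M' k = f M'' k) :
    (fill A f M).nat A k = f (fill A f M) k := by
  unfold fill
  rw [fillTo_nat_of_lt k.lt_succ_self hk, fillTo_nat_succ]
  refine hf _ _ (by rw [fillTo_real, fillTo_real])
    (fun a ha => by rw [fillTo_nat_of_ne ha, fillTo_nat_of_ne ha]) fun j hj => ?_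
  rw [fillTo_nat_of_lt j.lt_succ_self hj,
    fillTo_nat_of_lt (m' := M.bound) j.lt_succ_self (by omega)]

theorem performs_fill {A : ℕ} (h2 : A ≠ 2) (h3 : A ≠ 3) {f : State → ℕ → ℕ}
    (hf : NatComputable fun M (v : Fin 1 → ℕ) => f M (v 0)) : Performs (fill A f) := by
  obtain ⟨P, p, hP⟩ := hf (fun _ => 0) 1 (by simp)
  refine ⟨.seq (.setNat 2 (.lit 0) (.lit 0))
    (.loop (.natLt (.get 2 (.lit 0)) (.get 3 (.lit 0)))
      (.seq P (.seq (.setNat A (.get 2 (.lit 0)) (.get 2 (.lit 1)))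
        (.setNat 2 (.lit 0) (.add (.get 2 (.lit 0)) (.lit 1)))))),
    1 + (Polynomial.X * (p + (1 + 1) + 1) + 1), fun s => ?_⟩
  have hbound : ∀ k (s' : State), s'.clean = fillTo A f s.clean k → s'.bound = s.bound := by
    intro k s' h
    rw [← s'.clean_bound, h, ← s.clean_bound]
    unfold State.bound
    rw [fillTo_nat_of_ne h3.symm]
  obtain ⟨t, s', hx, ht, hA, hi⟩ := exec_loop (N := s.bound) (τ := p.eval s.bound + (1 + 1))
    (b := .natLt (.get 2 (.lit 0)) (.get 3 (.lit 0)))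
    (Q := .seq P (.seq (.setNat A (.get 2 (.lit 0)) (.get 2 (.lit 1)))
        (.setNat 2 (.lit 0) (.add (.get 2 (.lit 0)) (.lit 1)))))
    (fun k s' => s'.clean = fillTo A f s.clean k ∧ s'.nat 2 0 = k)
    (by
      rintro k hk s' ⟨hc, hi⟩
      have hb := hbound k s' hc
      refine ⟨?_, ?_⟩
      · simpa [Test.Holds, NatExpr.eval, hi, State.bound] using hk.trans_eq hb.symm
      obtain ⟨t, s'', hx, ht, hA', hv'⟩ := hP s'
      rw [hb] at ht
      refine ⟨_, _, .seq hx (.seq (.setNat _ _ _ _) (.setNat _ _ _ _)), by omega, ?_, ?_⟩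
      · simp only [NatExpr.eval, State.clean_writeNat_stack, State.clean_writeNat _ h2,
          hA'.clean, hA'.nat 0 one_pos, hv', hi, hc, fillTo]
      · simp [NatExpr.eval, hA'.nat 0 one_pos, hi, h2.symm])
    (by
      rintro s' ⟨hc, hi⟩
      simp only [Test.Holds, NatExpr.eval, hi, not_lt]
      exact (hbound _ s' hc).le)
    (s := s.writeNat 2 0 0) ⟨by simp [fillTo], by simp⟩
  refine ⟨_, _, .seq (.setNat _ _ _ _) hx, ?_, hA, hbound _ _ hA⟩
  simp only [Polynomial.eval_add, Polynomial.eval_one, Polynomial.eval_mul, Polynomial.eval_X]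
  omega

theorem NatComputable.bound_pow {d : ℕ} (k : ℕ) :
    NatComputable (d := d) fun M _ => M.bound ^ k := by
  induction k generalizing d with
  | zero => simpa using NatComputable.lit (d := d) 1
  | succ k ih =>
    have h := NatComputable.sum (d := d) (f := fun M _ _ => M.bound ^ k) ih
    simpa [pow_succ'] using h

/-- The loop bound can be set to any power of `n + 2` beforehand. -/
theorem Performs.exec_input {φ : State → State} (hφ : Performs φ) (k : ℕ) :
    ∃ (P : Program) (p : Polynomial ℕ), ∀ (n : ℕ) (B : Fin n → WeightedBox),
      ∃ t s, Exec P (input B) t s ∧ t ≤ p.eval n ∧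
        s.clean = φ ((input B).writeNat 3 0 ((n + 2) ^ k)) := by
  obtain ⟨P, p, hP⟩ := hφ
  obtain ⟨Q, q, hQ⟩ := NatComputable.bound_pow (d := 0) k (fun _ => 0) 0 (fun i => i.elim0)
  -- The bound is first set to `n + 2`, so that nested loops can compute its power on the stack; the
  -- power then replaces it.
  refine ⟨.seq (.setNat 3 (.lit 0) (.add (.get 0 (.lit 0)) (.lit 2)))
    (.seq Q (.seq (.setNat 3 (.lit 0) (.get 2 (.lit 0))) P)),
    1 + (q.comp (.X + 2) + (1 + p.comp ((.X + 2) ^ k))), fun n B => ?_⟩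
  set s₀ := (input B).writeNat 3 0 (n + 2) with hs₀
  have hb₀ : s₀.bound = n + 2 := by simp [s₀, State.bound]
  obtain ⟨t, s₁, hx, ht, hA, hv⟩ := hQ s₀
  replace hv : s₁.nat 2 0 = (n + 2) ^ k := by rw [hv, ← hb₀]; rfl
  rw [hb₀] at ht
  set s₂ := s₁.writeNat 3 0 ((n + 2) ^ k) with hs₂
  obtain ⟨t', s₃, hx', ht', hc, -⟩ := hP s₂
  have hb₂ : s₂.bound = (n + 2) ^ k := by simp [s₂, State.bound]
  rw [hb₂] at ht'
  have e₀ : Exec (.setNat 3 (.lit 0) (.add (.get 0 (.lit 0)) (.lit 2))) (input B) 1 s₀ := by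
    have := Exec.setNat 3 (.lit 0) (.add (.get 0 (.lit 0)) (.lit 2)) (input B)
    simpa [NatExpr.eval, input, s₀] using this
  have e₂ : Exec (.setNat 3 (.lit 0) (.get 2 (.lit 0))) s₁ 1 s₂ := by
    have := Exec.setNat 3 (.lit 0) (.get 2 (.lit 0)) s₁
    simpa [NatExpr.eval, hv, s₂] using this
  refine ⟨_, _, .seq e₀ (.seq hx (.seq e₂ hx')), ?_, ?_⟩
  · simp only [Polynomial.eval_add, Polynomial.eval_one, Polynomial.eval_comp,
      Polynomial.eval_pow, Polynomial.eval_X, Polynomial.eval_ofNat]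
    omega
  · rw [hc, hs₂, State.clean_writeNat _ (by decide), hA.clean]
    congr 1
    apply State.ext_cells
    · intro a i
      by_cases h3 : a = 3 ∧ i = 0
      · simp [h3]
      · by_cases h2 : a = 2
        · subst h2; simp [State.clean, input]
        · simp [State.clean, h2, s₀, h3]
    · intro a i
      by_cases h5 : a = 5
      · subst h5
        by_cases hi : i < n <;> simp [State.clean, input, hi, s₀]
      · simp [State.clean, h5, s₀]

end RealRAM

/-! ## The algorithm -/

namespace RealRAM

/-- Boxes given by arrays of coordinates and weights, of which the first `n` entries count. -/
structure BoxData where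
  n : ℕ
  l : ℕ → ℝ
  r : ℕ → ℝ
  b : ℕ → ℝ
  t : ℕ → ℝ
  w : ℕ → ℝ

/-- The boxes stored in the memory. -/
def State.boxes (M : State) : BoxData :=
  ⟨M.nat 0 0, M.real 0, M.real 1, M.real 2, M.real 3, M.real 4⟩

namespace BoxData

/-- Box `i` contains the grid point with the left coordinate of box `a` and the bottom coordinate
of box `c`. -/
def Covers (X : BoxData) (i a c : ℕ) : Prop :=
  i < X.n ∧ X.l i ≤ X.l a ∧ X.l a ≤ X.r i ∧ X.b i ≤ X.b c ∧ X.b c ≤ X.t i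

/-- Box `i` is narrower and taller than box `j`, or has the same projections. -/
def Prec (X : BoxData) (i j : ℕ) : Prop :=
  X.l j ≤ X.l i ∧ X.r i ≤ X.r j ∧ X.b i ≤ X.b j ∧ X.t j ≤ X.t i

/-- The strict version of `Prec`. -/
def SPrec (X : BoxData) (i j : ℕ) : Prop := X.Prec i j ∧ ¬ X.Prec j i

/-- Boxes `i` and `j` intersect. -/
def Meets (X : BoxData) (i j : ℕ) : Prop :=
  X.l i ≤ X.r j ∧ X.l j ≤ X.r i ∧ X.b i ≤ X.t j ∧ X.b j ≤ X.t i

/-- Boxes `i` and `j` intersect, but do not cross. -/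
def Conflict (X : BoxData) (i j : ℕ) : Prop :=
  X.Meets i j ∧ ¬ X.SPrec i j ∧ ¬ X.SPrec j i

open Classical in
/-- The number of boxes among `e 0, …, e (k - 1)` that contain a grid point. -/
noncomputable def load (X : BoxData) (L : ℕ) (e : ℕ → ℕ) (k a c : ℕ) : ℕ :=
  clipSum L k fun j => if X.Covers (e j) a c then 1 else 0

open Classical in
/-- The number of boxes of colour `z` among `e 0, …, e (k - 1)` that contain a grid point. -/
noncomputable def colorLoad (X : BoxData) (L : ℕ) (e col : ℕ → ℕ) (k a c z : ℕ) : ℕ :=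
  clipSum L k fun j => if X.Covers (e j) a c ∧ col j = z then 1 else 0

/-- A sum over all grid points. -/
def gridSum (X : BoxData) (L : ℕ) (f : ℕ → ℕ → ℕ) : ℕ :=
  clipSum L X.n fun a => clipSum L X.n fun c => f a c

/-- The total price of the grid points, where `pw` tells the price for each load. -/
noncomputable def totalPrice (X : BoxData) (L : ℕ) (pw e : ℕ → ℕ) (k : ℕ) : ℕ :=
  X.gridSum L fun a c => pw (X.load L e k a c)

open Classical in
/-- The total price of the grid points in box `i`. -/
noncomputable def price (X : BoxData) (L : ℕ) (pw e : ℕ → ℕ) (k i : ℕ) : ℕ :=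
  X.gridSum L fun a c => if X.Covers i a c then pw (X.load L e k a c) else 0

open Classical in
/-- Unless the total price has reached its limit, the next box is one with the least price per
weight. -/
noncomputable def pickRule (X : BoxData) (L T : ℕ) (pw e : ℕ → ℕ) (k : ℕ) : ℕ :=
  if X.totalPrice L pw e k < pw T then
    first L fun i => i < X.n ∧ ∀ j < L, j < X.n →
      -- The comparison of price per weight, with denominators cleared.
      clipSum L (X.price L pw e k i) (fun _ => X.w j) ≤
        clipSum L (X.price L pw e k j) (fun _ => X.w i)
  else X.n

/-- Position `u` holds a box and does not occur among `ord 0, …, ord (k - 1)`. -/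
def Remains (X : BoxData) (L : ℕ) (e ord : ℕ → ℕ) (k u : ℕ) : Prop :=
  e u < X.n ∧ ∀ j < L, j < k → ord j ≠ u

open Classical in
/-- The next position to be removed: one with at most `Q` conflicts among those that remain. -/
noncomputable def removeRule (X : BoxData) (L Q : ℕ) (e ord : ℕ → ℕ) (k : ℕ) : ℕ :=
  first L fun v => X.Remains L e ord k v ∧
    (∑ u ∈ Finset.range L,
      if X.Remains L e ord k u ∧ u ≠ v ∧ X.Conflict (e u) (e v) then 1 else 0) ≤ Q

/-- The boxes in the order opposite to that of removal. -/
def reverseRule (X : BoxData) (L : ℕ) (e ord : ℕ → ℕ) (k : ℕ) : ℕ :=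
  if ord (L - 1 - k) < L then e (ord (L - 1 - k)) else X.n

open Classical in
/-- The colour of the next box: one that causes no conflict and does not increase the
potential. -/
noncomputable def colorRule (X : BoxData) (L T Q : ℕ) (pw pq e col : ℕ → ℕ) (k : ℕ) : ℕ :=
  first L fun z => z < Q + Q + 1 ∧
    (∀ j < L, j < k → e j < X.n → X.Conflict (e j) (e k) → col j ≠ z) ∧
    -- The left side is the `gain` caused by colour `z`, the right side the `drop`, both with
    -- products written as sums.
    (X.gridSum L fun a c => if X.Covers (e k) a c then
      clipSum L (pw (T - 1 - X.load L e k a c)) fun _ =>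
        clipSum L Q fun _ => pq (X.colorLoad L e col k a c z) else 0) ≤
    X.gridSum L fun a c => if X.Covers (e k) a c then
      clipSum L (pw (T - 1 - X.load L e k a c)) fun _ =>
        clipSum L (Q + Q + 1) fun y => pq (X.colorLoad L e col k a c y) else 0

open Classical in
/-- The number of boxes of the same colour that cross box `e k` vertically and whose projections
contain the left coordinate of box `a`. -/
noncomputable def crossings (X : BoxData) (L : ℕ) (e col : ℕ → ℕ) (k a : ℕ) : ℕ :=
  ∑ j ∈ Finset.range L, if e j < X.n ∧ col j = col k ∧ X.SPrec (e j) (e k) ∧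
    X.l (e j) ≤ X.l a ∧ X.l a ≤ X.r (e j) then 1 else 0

/-- The maximal number of vertical crossings over a point of the horizontal projection. -/
noncomputable def levelRule (X : BoxData) (L : ℕ) (e col : ℕ → ℕ) (k : ℕ) : ℕ :=
  first L fun h => ∀ a < L, a < X.n → X.l (e k) ≤ X.l a → X.l a ≤ X.r (e k) →
    X.crossings L e col k a ≤ h

open Classical in
/-- The total weight of the boxes of given colour and level. -/
noncomputable def classWeight (X : BoxData) (L : ℕ) (e col lev : ℕ → ℕ) (z h : ℕ) : ℝ :=
  clipSum L L fun j => if e j < X.n ∧ col j = z ∧ lev j = h then X.w (e j) else 0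

/-- No class is heavier than that of colour `z` and level `h`. -/
def IsHeaviest (X : BoxData) (L : ℕ) (e col lev : ℕ → ℕ) (z h : ℕ) : Prop :=
  ∀ z' < L, ∀ h' < L, X.classWeight L e col lev z' h' ≤ X.classWeight L e col lev z h

open Classical in
/-- Select the boxes of the class of colour `z` and level `h`. -/
noncomputable def selectRule (X : BoxData) (L : ℕ) (e col lev : ℕ → ℕ) (z h i : ℕ) : ℕ :=
  if ∃ j < L, e j = i ∧ e j < X.n ∧ col j = z ∧ lev j = h then 1 else 0

end BoxData

/-! ### Computability of the rules -/

section Computability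

open NatComputable Classical

variable {d : ℕ} {f g h k : State → (Fin d → ℕ) → ℕ}

theorem natComputable_n : NatComputable (d := d) fun M _ => M.boxes.n :=
  .get 0 (by decide) (.lit 0)

theorem realComputable_l (hf : NatComputable f) : RealComputable fun M v => M.boxes.l (f M v) :=
  .get 0 (by decide) hf

theorem realComputable_r (hf : NatComputable f) : RealComputable fun M v => M.boxes.r (f M v) :=
  .get 1 (by decide) hf

theorem realComputable_b (hf : NatComputable f) : RealComputable fun M v => M.boxes.b (f M v) :=
  .get 2 (by decide) hf

theorem realComputable_t (hf : NatComputable f) : RealComputable fun M v => M.boxes.t (f M v) :=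
  .get 3 (by decide) hf

theorem realComputable_w (hf : NatComputable f) : RealComputable fun M v => M.boxes.w (f M v) :=
  .get 4 (by decide) hf

theorem decides_covers (hf : NatComputable f) (hg : NatComputable g) (hh : NatComputable h) :
    Decides fun M v => M.boxes.Covers (f M v) (g M v) (h M v) :=
  (Decides.lt hf natComputable_n).and <|
    (Decides.realLe (realComputable_l hf) (realComputable_l hg)).and <|
    (Decides.realLe (realComputable_l hg) (realComputable_r hf)).and <|
    (Decides.realLe (realComputable_b hf) (realComputable_b hh)).and
      (Decides.realLe (realComputable_b hh) (realComputable_t hf))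

theorem decides_prec (hf : NatComputable f) (hg : NatComputable g) :
    Decides fun M v => M.boxes.Prec (f M v) (g M v) :=
  (Decides.realLe (realComputable_l hg) (realComputable_l hf)).and <|
    (Decides.realLe (realComputable_r hf) (realComputable_r hg)).and <|
    (Decides.realLe (realComputable_b hf) (realComputable_b hg)).and
      (Decides.realLe (realComputable_t hg) (realComputable_t hf))

theorem decides_sPrec (hf : NatComputable f) (hg : NatComputable g) :
    Decides fun M v => M.boxes.SPrec (f M v) (g M v) :=
  (decides_prec hf hg).and (decides_prec hg hf).not

theorem decides_conflict (hf : NatComputable f) (hg : NatComputable g) :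
    Decides fun M v => M.boxes.Conflict (f M v) (g M v) :=
  ((Decides.realLe (realComputable_l hf) (realComputable_r hg)).and <|
    (Decides.realLe (realComputable_l hg) (realComputable_r hf)).and <|
    (Decides.realLe (realComputable_b hf) (realComputable_t hg)).and
      (Decides.realLe (realComputable_b hg) (realComputable_t hf))).and <|
    (decides_sPrec hf hg).not.and (decides_sPrec hg hf).not

theorem natComputable_load {A : ℕ} (hA : A ≠ 2) (hk : NatComputable k) (hf : NatComputable f)
    (hg : NatComputable g) :
    NatComputable fun M v => M.boxes.load M.bound (M.nat A) (k M v) (f M v) (g M v) :=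
  .clipSum hk (.ite (decides_covers (.get A hA (.var _)) hf.weaken hg.weaken) (.lit 1) (.lit 0))

theorem natComputable_colorLoad {A C : ℕ} (hA : A ≠ 2) (hC : C ≠ 2) (hk : NatComputable k)
    (hf : NatComputable f) (hg : NatComputable g) (hh : NatComputable h) :
    NatComputable fun M v =>
      M.boxes.colorLoad M.bound (M.nat A) (M.nat C) (k M v) (f M v) (g M v) (h M v) :=
  .clipSum hk (.ite ((decides_covers (.get A hA (.var _)) hf.weaken hg.weaken).and
    (.eq (.get C hC (.var _)) hh.weaken)) (.lit 1) (.lit 0))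

theorem natComputable_gridSum {F : State → (Fin d → ℕ) → ℕ → ℕ → ℕ}
    (hF : NatComputable fun M (v : Fin (d + 1 + 1) → ℕ) => F M (fun i => v i.castSucc.castSucc)
      (v (Fin.last d).castSucc) (v (Fin.last (d + 1)))) :
    NatComputable fun M v => M.boxes.gridSum M.bound (F M v) :=
  .clipSum natComputable_n (.clipSum natComputable_n hF)

theorem natComputable_totalPrice {W A : ℕ} (hW : W ≠ 2) (hA : A ≠ 2) (hk : NatComputable k) :
    NatComputable fun M v => M.boxes.totalPrice M.bound (M.nat W) (M.nat A) (k M v) :=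
  natComputable_gridSum (.get W hW (natComputable_load hA hk.weaken.weaken (.var _) (.var _)))

theorem natComputable_price {W A : ℕ} (hW : W ≠ 2) (hA : A ≠ 2) (hk : NatComputable k)
    (hf : NatComputable f) :
    NatComputable fun M v => M.boxes.price M.bound (M.nat W) (M.nat A) (k M v) (f M v) :=
  natComputable_gridSum (.ite (decides_covers hf.weaken.weaken (.var _) (.var _))
    (.get W hW (natComputable_load hA hk.weaken.weaken (.var _) (.var _))) (.lit 0))

theorem natComputable_pickRule {W A : ℕ} (hW : W ≠ 2) (hA : A ≠ 2) (hk : NatComputable k)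
    (hf : NatComputable f) :
    NatComputable fun M v => M.boxes.pickRule M.bound (f M v) (M.nat W) (M.nat A) (k M v) :=
  .ite (.lt (natComputable_totalPrice hW hA hk) (.get W hW hf))
    (.first ((Decides.lt (.var _) natComputable_n).and <| .all <| .imp
      (.lt (.var _) natComputable_n) <| .realLe
        (.clipSum (natComputable_price hW hA hk.weaken.weaken (.var _))
          (realComputable_w (.var _)))
        (.clipSum (natComputable_price hW hA hk.weaken.weaken (.var _))
          (realComputable_w (.var _)))))
    natComputable_n

theorem decides_remains {A C : ℕ} (hA : A ≠ 2) (hC : C ≠ 2) (hk : NatComputable k)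
    (hf : NatComputable f) :
    Decides fun M v => M.boxes.Remains M.bound (M.nat A) (M.nat C) (k M v) (f M v) :=
  (Decides.lt (.get A hA hf) natComputable_n).and <| .all <| .imp (.lt (.var _) hk.weaken)
    (.ne (.get C hC (.var _)) hf.weaken)

theorem natComputable_removeRule {A C : ℕ} (hA : A ≠ 2) (hC : C ≠ 2) (hk : NatComputable k)
    (hf : NatComputable f) :
    NatComputable fun M v => M.boxes.removeRule M.bound (f M v) (M.nat A) (M.nat C) (k M v) :=
  .first ((decides_remains hA hC hk.weaken (.var _)).and <| .le (.sum <| .ite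
    ((decides_remains hA hC hk.weaken.weaken (.var _)).and <|
      (Decides.ne (.var _) (.var _)).and <|
        decides_conflict (.get A hA (.var _)) (.get A hA (.var _)))
    (.lit 1) (.lit 0)) hf.weaken)

theorem natComputable_reverseRule {A C : ℕ} (hA : A ≠ 2) (hC : C ≠ 2) (hk : NatComputable k) :
    NatComputable fun M v => M.boxes.reverseRule M.bound (M.nat A) (M.nat C) (k M v) :=
  have h := NatComputable.get C hC ((bound.sub (.lit 1)).sub hk)
  .ite (.lt h bound) (.get A hA h) natComputable_n

theorem natComputable_colorRule {W V A C : ℕ} (hW : W ≠ 2) (hV : V ≠ 2) (hA : A ≠ 2)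
    (hC : C ≠ 2) (hk : NatComputable k) (hf : NatComputable f) (hg : NatComputable g) :
    NatComputable fun M v => M.boxes.colorRule M.bound (f M v) (g M v) (M.nat W) (M.nat V)
      (M.nat A) (M.nat C) (k M v) := by
  have hk1 := hk.weaken
  have hk3 := hk1.weaken.weaken
  have hg1 := hg.weaken
  have hg4 := hg1.weaken.weaken.weaken
  have hp : ∀ {i j}, NatComputable fun M (v : Fin (d + 1 + 1 + 1) → ℕ) =>
      M.nat W (f M (fun i => v i.castSucc.castSucc.castSucc) - 1 - M.boxes.load M.bound (M.nat A)
        (k M fun i => v i.castSucc.castSucc.castSucc) (v i) (v j)) := fun {i j} =>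
    .get W hW ((hf.weaken.weaken.weaken.sub (.lit 1)).sub
      (natComputable_load hA hk3 (.var i) (.var j)))
  exact .first ((Decides.lt (.var _) ((hg1.add hg1).add (.lit 1))).and <|
    (Decides.all <| .imp (.lt (.var _) hk1.weaken) <|
      .imp (.lt (.get A hA (.var _)) natComputable_n) <|
      .imp (decides_conflict (.get A hA (.var _)) (.get A hA hk1.weaken)) <|
        .ne (.get C hC (.var _)) (.var _)).and <|
    .le
      (natComputable_gridSum (.ite (decides_covers (.get A hA hk3) (.var _) (.var _))
        (.clipSum hp (.clipSum hg4
          (.get V hV (natComputable_colorLoad hA hC hk3.weaken.weaken (.var _) (.var _)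
            (.var _))))) (.lit 0)))
      (natComputable_gridSum (.ite (decides_covers (.get A hA hk3) (.var _) (.var _))
        (.clipSum hp (.clipSum ((hg4.add hg4).add (.lit 1))
          (.get V hV (natComputable_colorLoad hA hC hk3.weaken.weaken (.var _) (.var _)
            (.var _))))) (.lit 0))))

theorem natComputable_crossings {A C : ℕ} (hA : A ≠ 2) (hC : C ≠ 2) (hk : NatComputable k)
    (hf : NatComputable f) :
    NatComputable fun M v => M.boxes.crossings M.bound (M.nat A) (M.nat C) (k M v) (f M v) :=
  have hj : NatComputable fun (M : State) (v : Fin (d + 1) → ℕ) => M.nat A (v (Fin.last d)) :=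
    .get A hA (.var _)
  .sum <| .ite
    ((Decides.lt hj natComputable_n).and <|
      (Decides.eq (.get C hC (.var _)) (.get C hC hk.weaken)).and <|
      (decides_sPrec hj (.get A hA hk.weaken)).and <|
      (Decides.realLe (realComputable_l hj) (realComputable_l hf.weaken)).and
        (Decides.realLe (realComputable_l hf.weaken) (realComputable_r hj)))
    (.lit 1) (.lit 0)

theorem natComputable_levelRule {A C : ℕ} (hA : A ≠ 2) (hC : C ≠ 2) (hk : NatComputable k) :
    NatComputable fun M v => M.boxes.levelRule M.bound (M.nat A) (M.nat C) (k M v) :=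
  have hk2 := NatComputable.get A hA hk.weaken.weaken
  .first <| .all <| .imp (.lt (.var _) natComputable_n) <|
    .imp (.realLe (realComputable_l hk2) (realComputable_l (.var _))) <|
    .imp (.realLe (realComputable_l (.var _)) (realComputable_r hk2)) <|
    .le (natComputable_crossings hA hC hk.weaken.weaken (.var _)) (.var _)

theorem realComputable_classWeight {A C H : ℕ} (hA : A ≠ 2) (hC : C ≠ 2) (hH : H ≠ 2)
    (hf : NatComputable f) (hg : NatComputable g) :
    RealComputable fun M v => M.boxes.classWeight M.bound (M.nat A) (M.nat C) (M.nat H)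
      (f M v) (g M v) :=
  have hj : NatComputable fun (M : State) (v : Fin (d + 1) → ℕ) => M.nat A (v (Fin.last d)) :=
    .get A hA (.var _)
  .clipSum bound <| .ite
    ((Decides.lt hj natComputable_n).and <|
      (Decides.eq (.get C hC (.var _)) hf.weaken).and
        (Decides.eq (.get H hH (.var _)) hg.weaken))
    (realComputable_w hj) .zero

theorem decides_isHeaviest {A C H : ℕ} (hA : A ≠ 2) (hC : C ≠ 2) (hH : H ≠ 2)
    (hf : NatComputable f) (hg : NatComputable g) :
    Decides fun M v => M.boxes.IsHeaviest M.bound (M.nat A) (M.nat C) (M.nat H)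
      (f M v) (g M v) :=
  .all <| .all <| .realLe (realComputable_classWeight hA hC hH (.var _) (.var _))
    (realComputable_classWeight hA hC hH hf.weaken.weaken hg.weaken.weaken)

theorem natComputable_selectRule {A C H : ℕ} (hA : A ≠ 2) (hC : C ≠ 2) (hH : H ≠ 2)
    (hf : NatComputable f) (hg : NatComputable g) (hk : NatComputable k) :
    NatComputable fun M v => M.boxes.selectRule M.bound (M.nat A) (M.nat C) (M.nat H)
      (f M v) (g M v) (k M v) :=
  have hj : NatComputable fun (M : State) (v : Fin (d + 1) → ℕ) => M.nat A (v (Fin.last d)) :=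
    .get A hA (.var _)
  .ite (.ex <| (Decides.eq hj hk.weaken).and <| (Decides.lt hj natComputable_n).and <|
    (Decides.eq (.get C hC (.var _)) hf.weaken).and (.eq (.get H hH (.var _)) hg.weaken))
    (.lit 1) (.lit 0)

end Computability

end RealRAM

/-! ## The greedy multiset -/

namespace RealRAM

namespace BoxData

/-- The boxes are nonempty and have positive weights. -/
structure Valid (X : BoxData) : Prop where
  l_le_r : ∀ i < X.n, X.l i ≤ X.r i
  b_le_t : ∀ i < X.n, X.b i ≤ X.t i
  w_pos : ∀ i < X.n, 0 < X.w i

/-- The grid points. -/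
def grid (X : BoxData) : Finset (ℕ × ℕ) := Finset.range X.n ×ˢ Finset.range X.n

variable {X : BoxData} {L T k : ℕ} {e : ℕ → ℕ}

theorem gridSum_eq (hn : X.n ≤ L) (f : ℕ → ℕ → ℕ) :
    X.gridSum L f = ∑ p ∈ X.grid, f p.1 p.2 := by
  rw [gridSum, clipSum_eq hn, grid, Finset.sum_product]
  exact Finset.sum_congr rfl fun a _ => clipSum_eq hn _

theorem card_grid (X : BoxData) : X.grid.card = X.n * X.n := by simp [grid]

theorem Valid.covers_self (hX : X.Valid) {i : ℕ} (hi : i < X.n) : X.Covers i i i :=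
  ⟨hi, le_rfl, hX.l_le_r i hi, le_rfl, hX.b_le_t i hi⟩

theorem mem_grid {p : ℕ × ℕ} : p ∈ X.grid ↔ p.1 < X.n ∧ p.2 < X.n := by simp [grid]

@[simp] theorem load_zero (a c : ℕ) : X.load L e 0 a c = 0 := by simp [load, clipSum]

open Classical in
theorem load_succ (hk : k < L) (a c : ℕ) :
    X.load L e (k + 1) a c = X.load L e k a c + if X.Covers (e k) a c then 1 else 0 := by
  rw [load, load, clipSum_eq hk, clipSum_eq hk.le, Finset.sum_range_succ]

theorem load_mono {m : ℕ} (hkm : k ≤ m) (hm : m ≤ L) (a c : ℕ) :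
    X.load L e k a c ≤ X.load L e m a c := by
  rw [load, load, clipSum_eq hm, clipSum_eq (hkm.trans hm)]
  exact Finset.sum_le_sum_of_subset (Finset.range_subset_range.2 hkm)

open Classical in
/-- The weight of the boxes listed at the first `k` positions. -/
noncomputable def listWeight (X : BoxData) (e : ℕ → ℕ) (k : ℕ) : ℝ :=
  ∑ j ∈ Finset.range k, if e j < X.n then X.w (e j) else 0

/-- The total price, if a grid point of load `m` costs `2 ^ m`. -/
noncomputable def expPrice (X : BoxData) (L : ℕ) (e : ℕ → ℕ) (k : ℕ) : ℕ :=
  ∑ p ∈ X.grid, 2 ^ X.load L e k p.1 p.2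

open Classical in
/-- The price of a box, if a grid point of load `m` costs `2 ^ m`. -/
noncomputable def expBoxPrice (X : BoxData) (L : ℕ) (e : ℕ → ℕ) (k i : ℕ) : ℕ :=
  ∑ p ∈ X.grid, if X.Covers i p.1 p.2 then 2 ^ X.load L e k p.1 p.2 else 0

/-- `e` lists the boxes picked by the greedy rule, with prices up to `2 ^ T`. -/
structure IsGreedy (X : BoxData) (L T : ℕ) (pw e : ℕ → ℕ) : Prop where
  valid : X.Valid
  n_le : X.n ≤ L
  limit_le : 2 ^ T ≤ L
  pw_eq : ∀ k < L, pw k = 2 ^ k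
  eq_rule : ∀ k < L, e k = X.pickRule L T pw e k

namespace IsGreedy

variable {pw : ℕ → ℕ}

theorem limit_lt (h : X.IsGreedy L T pw e) : T < L := T.lt_two_pow_self.trans_le h.limit_le

theorem totalPrice_eq (h : X.IsGreedy L T pw e)
    (hl : ∀ p ∈ X.grid, X.load L e k p.1 p.2 ≤ T) :
    X.totalPrice L pw e k = X.expPrice L e k := by
  rw [totalPrice, gridSum_eq h.n_le]
  exact Finset.sum_congr rfl fun p hp => h.pw_eq _ ((hl p hp).trans_lt h.limit_lt)

theorem price_eq (h : X.IsGreedy L T pw e)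
    (hl : ∀ p ∈ X.grid, X.load L e k p.1 p.2 ≤ T) (i : ℕ) :
    X.price L pw e k i = X.expBoxPrice L e k i := by
  rw [price, gridSum_eq h.n_le]
  refine Finset.sum_congr rfl fun p hp => ?_
  rw [h.pw_eq _ ((hl p hp).trans_lt h.limit_lt)]

/-- The value `X.n` stands for no box, so a genuine box can only come from the first branch of the
rule. -/
theorem lt_of_pick (h : X.IsGreedy L T pw e) (hk : k < L) (he : e k < X.n) :
    X.totalPrice L pw e k < 2 ^ T := by
  rw [h.eq_rule k hk, pickRule, h.pw_eq T h.limit_lt] at he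
  by_contra hc
  rw [if_neg hc] at he
  exact absurd he (lt_irrefl _)

/-- If a box covering the point is picked, then the price `2 ^ load` of that point is part of a
total below `2 ^ T`; its load is thus less than `T` before the pick. -/
theorem load_le (h : X.IsGreedy L T pw e) (hk : k ≤ L) :
    ∀ p ∈ X.grid, X.load L e k p.1 p.2 ≤ T := by
  induction k with
  | zero => simp
  | succ k ih =>
    intro p hp
    have ih' := ih (by omega)
    rw [load_succ (by omega)]
    split_ifs with hc
    · have h1 := h.lt_of_pick (k := k) (by omega) hc.1
      rw [h.totalPrice_eq ih'] at h1
      have h2 : 2 ^ X.load L e k p.1 p.2 ≤ X.expPrice L e k :=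
        Finset.single_le_sum (f := fun p => 2 ^ X.load L e k p.1 p.2)
          (fun _ _ => Nat.zero_le _) hp
      exact (Nat.pow_lt_pow_iff_right (by norm_num)).1 (h2.trans_lt h1)
    · exact ih' p hp

/-- Each covered point doubles its price, so the total grows by exactly the price of the picked box.
-/
theorem expPrice_succ (hk : k < L) :
    X.expPrice L e (k + 1) = X.expPrice L e k + X.expBoxPrice L e k (e k) := by
  rw [expPrice, expPrice, expBoxPrice, ← Finset.sum_add_distrib]
  refine Finset.sum_congr rfl fun p _ => ?_
  rw [load_succ hk]
  split_ifs
  · rw [pow_succ]; ring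
  · rfl

theorem expBoxPrice_le (i : ℕ) : X.expBoxPrice L e k i ≤ X.expPrice L e k :=
  Finset.sum_le_sum fun p _ => by split_ifs <;> simp

theorem expBoxPrice_pos (hX : X.Valid) {i : ℕ} (hi : i < X.n) : 0 < X.expBoxPrice L e k i := by
  classical
  refine Finset.sum_pos' (fun _ _ => Nat.zero_le _) ⟨(i, i), mem_grid.2 ⟨hi, hi⟩, ?_⟩
  rw [if_pos (hX.covers_self hi)]
  positivity

/-- A picked box has the least price per weight. -/
theorem pick_spec (h : X.IsGreedy L T pw e) (hk : k < L) (hn : 0 < X.n)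
    (hlt : X.expPrice L e k < 2 ^ T) :
    e k < X.n ∧ ∀ j < X.n, X.expBoxPrice L e k (e k) * X.w j ≤
      X.expBoxPrice L e k j * X.w (e k) := by
  have hl := h.load_le hk.le
  -- Prices of boxes stay within the loop bound, so the clipped sums in the rule are true products.
  have hle : ∀ i, X.expBoxPrice L e k i ≤ L := fun i =>
    (expBoxPrice_le i).trans (hlt.le.trans h.limit_le)
  have hq : ∃ i < L, i < X.n ∧ ∀ j < L, j < X.n →
      clipSum L (X.price L pw e k i) (fun _ => X.w j) ≤
        clipSum L (X.price L pw e k j) (fun _ => X.w i) := by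
    obtain ⟨i, hi, hmin⟩ := Finset.exists_min_image (Finset.range X.n)
      (fun i => (X.expBoxPrice L e k i : ℝ) / X.w i) ⟨0, Finset.mem_range.2 hn⟩
    rw [Finset.mem_range] at hi
    refine ⟨i, hi.trans_le h.n_le, hi, fun j _ hj => ?_⟩
    have := hmin j (Finset.mem_range.2 hj)
    rw [div_le_div_iff₀ (h.valid.w_pos i hi) (h.valid.w_pos j hj)] at this
    rwa [h.price_eq hl, h.price_eq hl, clipSum_const_real (hle _), clipSum_const_real (hle _)]
  have hek : e k = _ := h.eq_rule k hk
  rw [pickRule, h.totalPrice_eq hl, h.pw_eq T h.limit_lt, if_pos hlt] at hek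
  have hs := (first_spec hq).2
  rw [← hek] at hs
  refine ⟨hs.1, fun j hj => ?_⟩
  have := hs.2 j (hj.trans_le h.n_le) hj
  rwa [h.price_eq hl, h.price_eq hl, clipSum_const_real (hle _),
    clipSum_const_real (hle _)] at this

/-- Every box covers the grid point at its own lower left corner and so has price at least `1`. Each
round below the limit therefore raises the total, and `2 ^ T ≤ L` rounds suffice to reach the limit.
-/
theorem le_expPrice (h : X.IsGreedy L T pw e) (hn : 0 < X.n) (hk : k ≤ L) :
    k ≤ X.expPrice L e k ∨ 2 ^ T ≤ X.expPrice L e k := by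
  induction k with
  | zero => simp
  | succ k ih =>
    rw [expPrice_succ (by omega)]
    rcases lt_or_ge (X.expPrice L e k) (2 ^ T) with hlt | hge
    · have := expBoxPrice_pos (L := L) (e := e) (k := k) h.valid
        (h.pick_spec (k := k) (by omega) hn hlt).1
      have := ih (by omega)
      omega
    · omega

theorem limit_le_expPrice (h : X.IsGreedy L T pw e) (hn : 0 < X.n) : 2 ^ T ≤ X.expPrice L e L :=
  (h.le_expPrice hn le_rfl).elim h.limit_le.trans id

/-- The prices in disjoint boxes add up to at most the total price. -/
theorem sum_expBoxPrice_le {J : Finset ℕ}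
    (hJ : ∀ i ∈ J, ∀ j ∈ J, i ≠ j → ∀ a c, ¬ (X.Covers i a c ∧ X.Covers j a c)) :
    ∑ i ∈ J, X.expBoxPrice L e k i ≤ X.expPrice L e k := by
  classical
  unfold expBoxPrice expPrice
  rw [Finset.sum_comm]
  refine Finset.sum_le_sum fun p _ => ?_
  by_cases hp : ∃ i ∈ J, X.Covers i p.1 p.2
  · obtain ⟨i, hi, hc⟩ := hp
    rw [Finset.sum_eq_single_of_mem i hi, if_pos hc]
    intro j hj hji
    rw [if_neg]
    exact fun hc' => hJ j hj i hi hji _ _ ⟨hc', hc⟩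
  · rw [Finset.sum_eq_zero]
    · exact Nat.zero_le _
    · intro i hi
      rw [if_neg fun hc => hp ⟨i, hi, hc⟩]

/-- Multiplicative weights: the prices over `J` sum to at most the total price, so the box of least
price per weight costs at most the total times `w / w(J)`. Each pick thus multiplies the total by at
most `1 + w / w(J) ≤ exp (w / w(J))`, starting from one unit per grid point. -/
theorem expPrice_le_exp (h : X.IsGreedy L T pw e) {J : Finset ℕ} (hJn : ∀ i ∈ J, i < X.n)
    (hJ : ∀ i ∈ J, ∀ j ∈ J, i ≠ j → ∀ a c, ¬ (X.Covers i a c ∧ X.Covers j a c))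
    (hne : J.Nonempty) (hk : k ≤ L) :
    (X.expPrice L e k : ℝ) ≤
      X.n * X.n * Real.exp (X.listWeight e k / ∑ i ∈ J, X.w i) := by
  have hO : 0 < ∑ i ∈ J, X.w i := Finset.sum_pos (fun i hi => h.valid.w_pos i (hJn i hi)) hne
  induction k with
  | zero => simp [expPrice, listWeight, card_grid]
  | succ k ih =>
    have ih := ih (by omega)
    rw [expPrice_succ (by omega), listWeight, Finset.sum_range_succ, ← listWeight]
    by_cases hek : e k < X.n
    · rw [if_pos hek]
      have hlt := h.lt_of_pick (k := k) (by omega) hek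
      rw [h.totalPrice_eq (h.load_le (by omega))] at hlt
      have hp := (h.pick_spec (k := k) (by omega) (by omega) hlt).2
      have h1 : (X.expBoxPrice L e k (e k) : ℝ) * ∑ i ∈ J, X.w i ≤
          X.expPrice L e k * X.w (e k) := by
        rw [Finset.mul_sum]
        refine (Finset.sum_le_sum fun j hj => hp j (hJn j hj)).trans ?_
        rw [← Finset.sum_mul]
        refine mul_le_mul_of_nonneg_right ?_ (h.valid.w_pos _ hek).le
        exact_mod_cast sum_expBoxPrice_le hJ
      have h2 : (X.expBoxPrice L e k (e k) : ℝ) ≤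
          X.expPrice L e k * (X.w (e k) / ∑ i ∈ J, X.w i) := by
        rwa [← mul_div_assoc, le_div_iff₀ hO]
      have h3 := Real.add_one_le_exp (X.w (e k) / ∑ i ∈ J, X.w i)
      rw [add_div, Real.exp_add, ← mul_assoc]
      push_cast
      calc (X.expPrice L e k : ℝ) + X.expBoxPrice L e k (e k)
          ≤ X.expPrice L e k * (X.w (e k) / ∑ i ∈ J, X.w i + 1) := by linarith
        _ ≤ X.expPrice L e k * Real.exp (X.w (e k) / ∑ i ∈ J, X.w i) := by gcongr
        _ ≤ _ := by gcongr
    · rw [if_neg hek, add_zero]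
      have : X.expBoxPrice L e k (e k) = 0 :=
        Finset.sum_eq_zero fun p _ => if_neg fun hc => hek hc.1
      simpa [this] using ih

/-- The picked boxes together weigh much more than any set of disjoint boxes. -/
theorem le_listWeight {ℓ : ℕ} (h : X.IsGreedy L (4 * ℓ) pw e) (hℓ : X.n ≤ 2 ^ ℓ) {J : Finset ℕ}
    (hJn : ∀ i ∈ J, i < X.n)
    (hJ : ∀ i ∈ J, ∀ j ∈ J, i ≠ j → ∀ a c, ¬ (X.Covers i a c ∧ X.Covers j a c)) :
    ℓ * ∑ i ∈ J, X.w i ≤ X.listWeight e L := by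
  rcases J.eq_empty_or_nonempty with rfl | hne
  · simp only [Finset.sum_empty, mul_zero]
    exact Finset.sum_nonneg fun j _ => by
      split_ifs with hj
      · exact (h.valid.w_pos _ hj).le
      · exact le_rfl
  have hO : 0 < ∑ i ∈ J, X.w i := Finset.sum_pos (fun i hi => h.valid.w_pos i (hJn i hi)) hne
  obtain ⟨i, hi⟩ := hne
  have h1 := h.expPrice_le_exp hJn hJ ⟨i, hi⟩ le_rfl
  have h2 : ((2 : ℝ) ^ (4 * ℓ)) ≤ X.expPrice L e L := by
    exact_mod_cast h.limit_le_expPrice (by have := hJn i hi; omega)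
  have hn : (X.n : ℝ) ≤ 2 ^ ℓ := by exact_mod_cast hℓ
  set E := Real.exp (X.listWeight e L / ∑ i ∈ J, X.w i) with hE
  have h3 : (2 : ℝ) ^ (4 * ℓ) ≤ 2 ^ (2 * ℓ) * E := by
    refine (h2.trans h1).trans ?_
    rw [two_mul, pow_add]
    gcongr
  -- The initial price `n ^ 2 ≤ 2 ^ (2 * ℓ)` uses up only half of the exponent `T = 4 * ℓ`.
  have h4 : (2 : ℝ) ^ (2 * ℓ) ≤ E := by
    have : (2 : ℝ) ^ (4 * ℓ) = 2 ^ (2 * ℓ) * 2 ^ (2 * ℓ) := by rw [← pow_add]; ring_nf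
    rw [this] at h3
    exact le_of_mul_le_mul_left h3 (by positivity)
  have h5 := Real.log_le_log (by positivity) h4
  rw [hE, Real.log_exp, Real.log_pow, le_div_iff₀ hO] at h5
  refine le_trans ?_ h5
  refine mul_le_mul_of_nonneg_right ?_ hO.le
  -- It remains to use `2 * log 2 ≥ 1`.
  have := Real.log_two_gt_d9
  push_cast
  nlinarith [(Nat.cast_nonneg ℓ : (0 : ℝ) ≤ ℓ)]

end IsGreedy

end BoxData

end RealRAM

/-! ## The order of the boxes -/

namespace RealRAM

namespace BoxData

variable {X : BoxData} {L T Q k : ℕ} {e ord : ℕ → ℕ}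

/-- Box `i` contains the point `p`. -/
def Inside (X : BoxData) (i : ℕ) (p : ℝ × ℝ) : Prop :=
  X.l i ≤ p.1 ∧ p.1 ≤ X.r i ∧ X.b i ≤ p.2 ∧ p.2 ≤ X.t i

/-- The four corners of a box. -/
def corner (X : BoxData) (i : ℕ) (q : Bool × Bool) : ℝ × ℝ :=
  (if q.1 then X.l i else X.r i, if q.2 then X.b i else X.t i)

/-- If two boxes are in conflict, then one of them contains a corner of the other. -/
theorem Conflict.exists_corner {i j : ℕ} (h : X.Conflict i j) :
    (∃ q, X.Inside i (X.corner j q)) ∨ ∃ q, X.Inside j (X.corner i q) := by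
  obtain ⟨⟨h1, h2, h3, h4⟩, h5, h6⟩ := h
  simp only [SPrec, Prec] at h5 h6
  simp only [Inside, corner, Prod.exists, Bool.exists_bool, if_true, Bool.false_eq_true, if_false]
  -- On each axis the projections intersect, so one has an endpoint in the other. If no corner is
  -- contained, then one box is strictly inside on one axis and the other on the other axis: they
  -- cross.
  by_contra hc
  push Not at hc
  grind

open Classical in
/-- A bound on the depth at the grid points is a bound on the depth everywhere. -/
theorem card_inside_le {V : Finset ℕ} (hV : ∀ v ∈ V, e v < X.n)
    (hT : ∀ p ∈ X.grid, (V.filter fun v => X.Covers (e v) p.1 p.2).card ≤ T) (p : ℝ × ℝ) :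
    (V.filter fun v => X.Inside (e v) p).card ≤ T := by
  rcases (V.filter fun v => X.Inside (e v) p).eq_empty_or_nonempty with h0 | hne
  · simp [h0]
  -- The largest left and the largest bottom coordinate among the boxes through `p` define a grid
  -- point that lies in all of them.
  obtain ⟨a, ha, ha'⟩ := Finset.exists_max_image _ (fun v => X.l (e v)) hne
  obtain ⟨c, hc, hc'⟩ := Finset.exists_max_image _ (fun v => X.b (e v)) hne
  rw [Finset.mem_filter] at ha hc
  refine le_trans (Finset.card_le_card fun v hv => ?_)
    (hT (e a, e c) (mem_grid.2 ⟨hV a ha.1, hV c hc.1⟩))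
  have h1 := ha' v hv
  have h2 := hc' v hv
  rw [Finset.mem_filter] at hv ⊢
  exact ⟨hv.1, hV v hv.1, h1, ha.2.1.trans hv.2.2.1, h2, hc.2.2.2.1.trans hv.2.2.2.2⟩

open Classical in
/-- Some position has few conflicts. -/
theorem exists_few_conflicts {V : Finset ℕ} (hV : ∀ v ∈ V, e v < X.n) (hne : V.Nonempty)
    (hT : ∀ p ∈ X.grid, (V.filter fun v => X.Covers (e v) p.1 p.2).card ≤ T) :
    ∃ v ∈ V, (V.filter fun u => X.Conflict (e u) (e v)).card ≤ 8 * T := by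
  have hin : ∀ v, (V.filter fun u => ∃ q, X.Inside (e u) (X.corner (e v) q)).card ≤ 4 * T := by
    intro v
    calc (V.filter fun u => ∃ q, X.Inside (e u) (X.corner (e v) q)).card
        ≤ ((Finset.univ : Finset (Bool × Bool)).biUnion fun q =>
            V.filter fun u => X.Inside (e u) (X.corner (e v) q)).card := by
          refine Finset.card_le_card fun u hu => ?_
          rw [Finset.mem_filter] at hu
          obtain ⟨hu, q, hq⟩ := hu
          exact Finset.mem_biUnion.2 ⟨q, Finset.mem_univ q, Finset.mem_filter.2 ⟨hu, hq⟩⟩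
      _ ≤ (Finset.univ : Finset (Bool × Bool)).card * T :=
          Finset.card_biUnion_le_card_mul _ _ _ fun q _ => card_inside_le hV hT _
      _ = 4 * T := by simp
  -- It suffices to bound the average. Each conflict is charged to a corner of one box inside the
  -- other; by symmetry both kinds of charges total at most four corners times depth `T` per box.
  refine Finset.exists_le_of_sum_le (g := fun _ => 8 * T) hne ?_
  calc ∑ v ∈ V, (V.filter fun u => X.Conflict (e u) (e v)).card
      ≤ ∑ v ∈ V, ((V.filter fun u => ∃ q, X.Inside (e u) (X.corner (e v) q)).card +
          (V.filter fun u => ∃ q, X.Inside (e v) (X.corner (e u) q)).card) := by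
        refine Finset.sum_le_sum fun v _ => le_trans (Finset.card_le_card fun u hu => ?_)
          (Finset.card_union_le _ _)
        rw [Finset.mem_filter] at hu
        rw [Finset.mem_union, Finset.mem_filter, Finset.mem_filter]
        exact hu.2.exists_corner.imp (fun h => ⟨hu.1, h⟩) fun h => ⟨hu.1, h⟩
    _ = ∑ v ∈ V, ((V.filter fun u => ∃ q, X.Inside (e u) (X.corner (e v) q)).card +
          (V.filter fun u => ∃ q, X.Inside (e u) (X.corner (e v) q)).card) := by
        rw [Finset.sum_add_distrib, Finset.sum_add_distrib]
        congr 1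
        simp only [Finset.card_filter]
        exact Finset.sum_comm
    _ ≤ ∑ v ∈ V, 8 * T := Finset.sum_le_sum fun v _ => by have := hin v; omega

/-- `ord` lists positions in the order of removal. -/
structure IsRemoval (X : BoxData) (L T : ℕ) (e ord : ℕ → ℕ) : Prop where
  load_le : ∀ p ∈ X.grid, X.load L e L p.1 p.2 ≤ T
  eq_rule : ∀ k < L, ord k = X.removeRule L (8 * T) e ord k

namespace IsRemoval

theorem remains (h : X.IsRemoval L T e ord) (hk : k < L) (ho : ord k < L) :
    X.Remains L e ord k (ord k) := by
  have hek := h.eq_rule k hk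
  rw [removeRule] at hek
  have := first_of_lt (hek ▸ ho)
  rw [← hek] at this
  exact this.1

open Classical in
theorem card_conflict_le (h : X.IsRemoval L T e ord) (hk : k < L) (ho : ord k < L) :
    ((Finset.range L).filter fun u => X.Remains L e ord k u ∧ u ≠ ord k ∧
      X.Conflict (e u) (e (ord k))).card ≤ 8 * T := by
  have hek := h.eq_rule k hk
  rw [removeRule] at hek
  have := first_of_lt (hek ▸ ho)
  rw [← hek] at this
  simpa only [Finset.sum_boole, Nat.cast_id] using this.2

/-- What remains is a submultiset of depth at most `T`, so if it is nonempty it has a member with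
few conflicts and the search succeeds. -/
theorem ord_lt (h : X.IsRemoval L T e ord) (hk : k < L) {v : ℕ} (hv : v < L)
    (hr : X.Remains L e ord k v) : ord k < L := by
  classical
  obtain ⟨v', hv', hc⟩ := exists_few_conflicts (X := X) (e := e) (T := T)
    (V := (Finset.range L).filter fun u => X.Remains L e ord k u)
    (fun u hu => (Finset.mem_filter.1 hu).2.1) ⟨v, Finset.mem_filter.2 ⟨Finset.mem_range.2 hv, hr⟩⟩
    (fun p hp => by
      refine le_trans ?_ (h.load_le p hp)
      rw [load, clipSum_eq le_rfl, ← Finset.card_filter]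
      exact Finset.card_le_card (Finset.filter_subset_filter _ (Finset.filter_subset _ _)))
  rw [Finset.mem_filter, Finset.mem_range] at hv'
  rw [h.eq_rule k hk]
  refine (first_spec ⟨v', hv'.1, hv'.2, ?_⟩).1
  rw [Finset.sum_boole, Nat.cast_id]
  refine le_trans (Finset.card_le_card fun u hu => ?_) hc
  rw [Finset.mem_filter] at hu
  simp only [Finset.mem_filter]
  exact ⟨⟨hu.1, hu.2.1⟩, hu.2.2.2⟩

theorem ord_ne (h : X.IsRemoval L T e ord) {j k : ℕ} (hjk : j < k) (hk : k < L)
    (ho : ord k < L) : ord j ≠ ord k :=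
  (h.remains hk ho).2 j (hjk.trans hk) hjk

theorem ord_inj (h : X.IsRemoval L T e ord) {j k : ℕ} (hj : j < L) (hk : k < L)
    (ho : ord k < L) (hjk : ord j = ord k) : j = k := by
  rcases lt_trichotomy j k with hlt | heq | hgt
  · exact absurd hjk (h.ord_ne hlt hk ho)
  · exact heq
  · exact absurd hjk.symm (h.ord_ne hgt hj (hjk ▸ ho))

/-- If `v` were never removed, all `L` removals would succeed, with distinct results among the `L -
1` positions other than `v`. -/
theorem exists_ord (h : X.IsRemoval L T e ord) {v : ℕ} (hv : v < L) (hev : e v < X.n) :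
    ∃ k < L, ord k = v := by
  by_contra! hc
  have hlt : ∀ k < L, ord k < L := fun k hk => h.ord_lt hk hv ⟨hev, fun j hj _ => hc j hj⟩
  have hcard : (Finset.range L).card ≤ ((Finset.range L).erase v).card := by
    refine Finset.card_le_card_of_injOn ord (fun k hk => ?_) fun j hj k hk hjk => ?_
    · have hk := Finset.mem_range.1 hk
      exact Finset.mem_coe.2 (Finset.mem_erase.2 ⟨hc k hk, Finset.mem_range.2 (hlt k hk)⟩)
    · have hj := Finset.mem_range.1 (Finset.mem_coe.1 hj)
      have hk := Finset.mem_range.1 (Finset.mem_coe.1 hk)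
      exact h.ord_inj hj hk (hlt k hk) hjk
  rw [Finset.card_erase_of_mem (Finset.mem_range.2 hv), Finset.card_range] at hcard
  omega

variable {s : ℕ → ℕ}

theorem reverse_lt (hs : ∀ k < L, s k = X.reverseRule L e ord k) (hk : k < L)
    (h : s k < X.n) : ord (L - 1 - k) < L ∧ s k = e (ord (L - 1 - k)) := by
  have hsk := hs k hk
  rw [reverseRule] at hsk
  split_ifs at hsk with ho
  · exact ⟨ho, hsk⟩
  · omega

open Classical in
/-- Reversal of the order of removal does not affect sums over all boxes. -/
theorem sum_reverse {α : Type*} [AddCommMonoid α] (h : X.IsRemoval L T e ord)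
    (hs : ∀ k < L, s k = X.reverseRule L e ord k) (g : ℕ → α) :
    (∑ k ∈ Finset.range L, if s k < X.n then g (s k) else 0) =
      ∑ k ∈ Finset.range L, if e k < X.n then g (e k) else 0 := by
  rw [← Finset.sum_filter, ← Finset.sum_filter]
  refine Finset.sum_bij (fun k _ => ord (L - 1 - k)) ?_ ?_ ?_ ?_
  · intro k hk
    rw [Finset.mem_filter, Finset.mem_range] at hk ⊢
    obtain ⟨h1, h2⟩ := reverse_lt hs hk.1 hk.2
    exact ⟨h1, h2 ▸ hk.2⟩
  · intro j hj k hk hjk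
    rw [Finset.mem_filter, Finset.mem_range] at hj hk
    have := h.ord_inj (j := L - 1 - j) (k := L - 1 - k) (by omega) (by omega)
      (reverse_lt hs hk.1 hk.2).1 hjk
    omega
  · intro v hv
    rw [Finset.mem_filter, Finset.mem_range] at hv
    obtain ⟨k, hk, rfl⟩ := h.exists_ord hv.1 hv.2
    have e1 : L - 1 - (L - 1 - k) = k := by omega
    refine ⟨L - 1 - k, ?_, by simp only [e1]⟩
    rw [Finset.mem_filter, Finset.mem_range, hs _ (by omega), reverseRule, e1, if_pos hv.1]
    exact ⟨by omega, hv.2⟩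
  · intro k hk
    rw [Finset.mem_filter, Finset.mem_range] at hk
    rw [(reverse_lt hs hk.1 hk.2).2]

theorem load_reverse (h : X.IsRemoval L T e ord)
    (hs : ∀ k < L, s k = X.reverseRule L e ord k) (a c : ℕ) :
    X.load L s L a c = X.load L e L a c := by
  classical
  have key : ∀ f : ℕ → ℕ, X.load L f L a c =
      ∑ k ∈ Finset.range L, if f k < X.n then (if X.Covers (f k) a c then 1 else 0) else 0 := by
    intro f
    rw [load, clipSum_eq le_rfl]
    refine Finset.sum_congr rfl fun k _ => ?_
    by_cases hf : f k < X.n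
    · simp [hf]
    · have : ¬ X.Covers (f k) a c := fun hc => hf hc.1
      simp [hf, this]
  rw [key, key, h.sum_reverse hs fun i => if X.Covers i a c then 1 else 0]

theorem listWeight_reverse (h : X.IsRemoval L T e ord)
    (hs : ∀ k < L, s k = X.reverseRule L e ord k) : X.listWeight s L = X.listWeight e L :=
  h.sum_reverse hs X.w

open Classical in
/-- In the reversed order every box has few conflicts with earlier boxes. -/
theorem card_conflict_reverse_le (h : X.IsRemoval L T e ord)
    (hs : ∀ k < L, s k = X.reverseRule L e ord k) (hk : k < L) (hsk : s k < X.n) :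
    ((Finset.range k).filter fun j => s j < X.n ∧ X.Conflict (s j) (s k)).card ≤ 8 * T := by
  obtain ⟨ho, hek⟩ := reverse_lt hs hk hsk
  refine le_trans ?_ (h.card_conflict_le (k := L - 1 - k) (by omega) ho)
  -- An earlier box in the reversed list is removed later, so it still remains when box `s k` is
  -- removed.
  refine Finset.card_le_card_of_injOn (fun j => ord (L - 1 - j)) (fun j hj => ?_)
    fun i hi j hj hij => ?_
  · simp only [Finset.coe_filter, Finset.mem_range, Set.mem_ofPred_eq] at hj ⊢
    obtain ⟨ho', hej⟩ := reverse_lt hs (hj.1.trans hk) hj.2.1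
    have hlt : L - 1 - k < L - 1 - j := by omega
    refine ⟨ho', ⟨hej ▸ hj.2.1, fun i hi hik => ?_⟩, ?_, ?_⟩
    · exact h.ord_ne (hik.trans hlt) (by omega) ho'
    · exact (h.ord_ne hlt (by omega) ho').symm
    · rw [← hej, ← hek]; exact hj.2.2
  · simp only [Finset.coe_filter, Finset.mem_range, Set.mem_ofPred_eq] at hi hj
    have := h.ord_inj (j := L - 1 - i) (k := L - 1 - j) (by omega) (by omega)
      (reverse_lt hs (hj.1.trans hk) hj.2.1).1 hij
    omega

end IsRemoval

end BoxData

end RealRAM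

/-! ## Colours and levels -/

namespace RealRAM

namespace BoxData

variable {X : BoxData} {L T k : ℕ} {pw pq s col lev : ℕ → ℕ}

@[simp] theorem colorLoad_zero (a c z : ℕ) : X.colorLoad L s col 0 a c z = 0 := by
  simp [colorLoad, clipSum]

open Classical in
theorem colorLoad_succ (hk : k < L) (a c z : ℕ) :
    X.colorLoad L s col (k + 1) a c z =
      X.colorLoad L s col k a c z + if X.Covers (s k) a c ∧ col k = z then 1 else 0 := by
  rw [colorLoad, colorLoad, clipSum_eq hk, clipSum_eq hk.le, Finset.sum_range_succ]

theorem colorLoad_le_load (hk : k ≤ L) (a c z : ℕ) :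
    X.colorLoad L s col k a c z ≤ X.load L s k a c := by
  rw [colorLoad, load, clipSum_eq hk, clipSum_eq hk]
  exact Finset.sum_le_sum fun j _ => by split_ifs <;> simp_all

/-- `col` lists colours for the boxes listed by `s`. -/
structure IsColoring (X : BoxData) (L T : ℕ) (pw pq s col : ℕ → ℕ) : Prop where
  n_le : X.n ≤ L
  limit_le : 2 ^ T ≤ L
  colors_le : 8 * T + 8 * T + 1 ≤ L
  pw_eq : ∀ k < L, pw k = 2 ^ k
  pq_eq : ∀ k < L, pq k = (8 * T + 1) ^ k
  load_le : ∀ p ∈ X.grid, X.load L s L p.1 p.2 ≤ T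
  few_conflicts : ∀ k < L, s k < X.n → ∀ V ⊆ Finset.range k,
    (∀ j ∈ V, s j < X.n ∧ X.Conflict (s j) (s k)) → V.card ≤ 8 * T
  eq_rule : ∀ k < L, col k = X.colorRule L T (8 * T) pw pq s col k

/-- The share of a grid point in the potential. -/
noncomputable def colorSum (X : BoxData) (L T : ℕ) (s col : ℕ → ℕ) (k : ℕ) (p : ℕ × ℕ) : ℕ :=
  ∑ z ∈ Finset.range (8 * T + 8 * T + 1), (8 * T + 1) ^ X.colorLoad L s col k p.1 p.2 z

/-- The potential that governs the choice of the colours. -/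
noncomputable def potential (X : BoxData) (L T : ℕ) (s col : ℕ → ℕ) (k : ℕ) : ℕ :=
  ∑ p ∈ X.grid, 2 ^ (T - X.load L s k p.1 p.2) * X.colorSum L T s col k p

open Classical in
/-- The increase of the potential that the choice of colour `z` causes. -/
noncomputable def gain (X : BoxData) (L T : ℕ) (s col : ℕ → ℕ) (k z : ℕ) : ℕ :=
  ∑ p ∈ X.grid, if X.Covers (s k) p.1 p.2 then
    2 ^ (T - 1 - X.load L s k p.1 p.2) *
      (8 * T * (8 * T + 1) ^ X.colorLoad L s col k p.1 p.2 z) else 0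

open Classical in
/-- The decrease of the potential when a box has been treated. -/
noncomputable def drop (X : BoxData) (L T : ℕ) (s col : ℕ → ℕ) (k : ℕ) : ℕ :=
  ∑ p ∈ X.grid, if X.Covers (s k) p.1 p.2 then
    2 ^ (T - 1 - X.load L s k p.1 p.2) * X.colorSum L T s col k p else 0

namespace IsColoring

theorem limit_lt (h : X.IsColoring L T pw pq s col) : T < L :=
  T.lt_two_pow_self.trans_le h.limit_le

theorem load_le' (h : X.IsColoring L T pw pq s col) (hk : k ≤ L) {p : ℕ × ℕ} (hp : p ∈ X.grid) :
    X.load L s k p.1 p.2 ≤ T :=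
  (load_mono hk le_rfl _ _).trans (h.load_le p hp)

theorem colorLoad_le (h : X.IsColoring L T pw pq s col) (hk : k ≤ L) {p : ℕ × ℕ}
    (hp : p ∈ X.grid) (z : ℕ) : X.colorLoad L s col k p.1 p.2 z ≤ T :=
  (colorLoad_le_load hk _ _ _).trans (h.load_le' hk hp)

theorem pw_sub_eq (h : X.IsColoring L T pw pq s col) (m : ℕ) : pw (T - m) = 2 ^ (T - m) :=
  h.pw_eq _ (by have := h.limit_lt; omega)

theorem pow_sub_le (h : X.IsColoring L T pw pq s col) (m : ℕ) : 2 ^ (T - m) ≤ L :=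
  (Nat.pow_le_pow_right (by norm_num) (Nat.sub_le _ _)).trans h.limit_le

open Classical in
-- Loads are at most `T` and all factors used as counts are at most `L`, so no product in the rule
-- is clipped.
theorem colorRule_eq (h : X.IsColoring L T pw pq s col) (hk : k < L) :
    col k = first L fun z => z < 8 * T + 8 * T + 1 ∧
      (∀ j < L, j < k → s j < X.n → X.Conflict (s j) (s k) → col j ≠ z) ∧
      X.gain L T s col k z ≤ X.drop L T s col k := by
  rw [h.eq_rule k hk, colorRule]
  congr 1
  funext z
  rw [gridSum_eq h.n_le, gridSum_eq h.n_le]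
  have e1 : X.gain L T s col k z = ∑ p ∈ X.grid, if X.Covers (s k) p.1 p.2 then
      clipSum L (pw (T - 1 - X.load L s k p.1 p.2)) fun _ =>
        clipSum L (8 * T) fun _ => pq (X.colorLoad L s col k p.1 p.2 z) else 0 := by
    refine Finset.sum_congr rfl fun p hp => ?_
    rw [Nat.sub_sub, h.pw_sub_eq, clipSum_const (h.pow_sub_le _),
      clipSum_const (by have := h.colors_le; omega),
      h.pq_eq _ ((h.colorLoad_le hk.le hp z).trans_lt h.limit_lt)]
  have e2 : X.drop L T s col k = ∑ p ∈ X.grid, if X.Covers (s k) p.1 p.2 then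
      clipSum L (pw (T - 1 - X.load L s k p.1 p.2)) fun _ =>
        clipSum L (8 * T + 8 * T + 1) fun y => pq (X.colorLoad L s col k p.1 p.2 y) else 0 := by
    refine Finset.sum_congr rfl fun p hp => ?_
    rw [Nat.sub_sub, h.pw_sub_eq, clipSum_const (h.pow_sub_le _), clipSum_eq h.colors_le,
      colorSum, Finset.sum_congr rfl fun y _ =>
        (h.pq_eq _ ((h.colorLoad_le hk.le hp y).trans_lt h.limit_lt)).symm]
  rw [e1, e2]

/-- On average, an admissible colour does not increase the potential. -/
theorem sum_gain (Z : Finset ℕ) (hZ : Z ⊆ Finset.range (8 * T + 8 * T + 1)) :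
    ∑ z ∈ Z, X.gain L T s col k z ≤ 8 * T * X.drop L T s col k := by
  unfold gain drop
  rw [Finset.sum_comm, Finset.mul_sum]
  refine Finset.sum_le_sum fun p _ => ?_
  split_ifs
  · rw [← Finset.mul_sum, ← Finset.mul_sum, mul_left_comm]
    gcongr
    exact Finset.sum_le_sum_of_subset hZ
  · simp

/-- Conflicts exclude at most `8 * T` of the `16 * T + 1` colours. The gains of the remaining
colours, at least `8 * T + 1` in number, sum to at most `8 * T` times the drop, so one of them gains
no more than the drop. -/
theorem col_spec (h : X.IsColoring L T pw pq s col) (hk : k < L) (hs : s k < X.n) :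
    col k < 8 * T + 8 * T + 1 ∧
      (∀ j < k, s j < X.n → X.Conflict (s j) (s k) → col j ≠ col k) ∧
      X.gain L T s col k (col k) ≤ X.drop L T s col k := by
  classical
  set V := (Finset.range k).filter fun j => s j < X.n ∧ X.Conflict (s j) (s k) with hV
  have hVc : V.card ≤ 8 * T := h.few_conflicts k hk hs V (Finset.filter_subset _ _)
    fun j hj => (Finset.mem_filter.1 hj).2
  set Z := Finset.range (8 * T + 8 * T + 1) \ V.image col with hZ
  have hZc : 8 * T + 1 ≤ Z.card := by
    have h1 : _ ≤ Z.card :=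
      Finset.le_card_sdiff (V.image col) (Finset.range (8 * T + 8 * T + 1))
    have h2 : (V.image col).card ≤ V.card := Finset.card_image_le
    rw [Finset.card_range] at h1
    omega
  obtain ⟨z, hz, hgz⟩ : ∃ z ∈ Z, X.gain L T s col k z ≤ X.drop L T s col k := by
    refine Finset.exists_le_of_sum_le (Finset.card_pos.1 (by omega))
      ((sum_gain Z Finset.sdiff_subset).trans ?_)
    rw [Finset.sum_const, smul_eq_mul]
    exact Nat.mul_le_mul_right _ (by omega)
  rw [hZ, Finset.mem_sdiff, Finset.mem_range] at hz
  have hsp := (first_spec (L := L) (q := fun z => z < 8 * T + 8 * T + 1 ∧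
      (∀ j < L, j < k → s j < X.n → X.Conflict (s j) (s k) → col j ≠ z) ∧
      X.gain L T s col k z ≤ X.drop L T s col k)
    ⟨z, hz.1.trans_le h.colors_le, hz.1, fun j _ hjk hj hc heq => hz.2
      (Finset.mem_image.2 ⟨j, Finset.mem_filter.2 ⟨Finset.mem_range.2 hjk, hj, hc⟩, heq⟩),
      hgz⟩).2
  rw [← h.colorRule_eq hk] at hsp
  exact ⟨hsp.1, fun j hj => hsp.2.1 j (hj.trans hk) hj, hsp.2.2⟩

open Classical in
theorem colorSum_succ (hk : k < L) (hz : col k < 8 * T + 8 * T + 1) (p : ℕ × ℕ) :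
    X.colorSum L T s col (k + 1) p = X.colorSum L T s col k p +
      if X.Covers (s k) p.1 p.2 then
        8 * T * (8 * T + 1) ^ X.colorLoad L s col k p.1 p.2 (col k) else 0 := by
  unfold colorSum
  by_cases hc : X.Covers (s k) p.1 p.2
  · have : ∀ z, (8 * T + 1) ^ X.colorLoad L s col (k + 1) p.1 p.2 z =
        (8 * T + 1) ^ X.colorLoad L s col k p.1 p.2 z +
          if col k = z then 8 * T * (8 * T + 1) ^ X.colorLoad L s col k p.1 p.2 z else 0 := by
      intro z
      rw [colorLoad_succ hk]
      by_cases hz : col k = z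
      · simp only [hc, hz, and_self, if_true, pow_succ]; ring
      · simp [hz]
    simp only [this, Finset.sum_add_distrib, Finset.sum_ite_eq, Finset.mem_range, hz, if_true, hc]
  · simp [colorLoad_succ hk, hc]

/-- At a covered point the factor `2 ^ (T - load)` is halved, which loses `drop`; the increase of
the colour sum, weighted by the halved factor, is `gain`. -/
theorem potential_succ_le (h : X.IsColoring L T pw pq s col) (hk : k < L) :
    X.potential L T s col (k + 1) ≤ X.potential L T s col k := by
  classical
  by_cases hs : s k < X.n
  · obtain ⟨hz, -, hg⟩ := h.col_spec hk hs
    have key : X.potential L T s col (k + 1) + X.drop L T s col k =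
        X.potential L T s col k + X.gain L T s col k (col k) := by
      unfold potential drop gain
      rw [← Finset.sum_add_distrib, ← Finset.sum_add_distrib]
      refine Finset.sum_congr rfl fun p hp => ?_
      rw [colorSum_succ hk hz, load_succ hk]
      by_cases hc : X.Covers (s k) p.1 p.2
      · have h1 := h.load_le' (k := k + 1) hk hp
        rw [load_succ hk, if_pos hc] at h1
        have e1 : T - X.load L s k p.1 p.2 = (T - 1 - X.load L s k p.1 p.2) + 1 := by omega
        have e2 : T - (X.load L s k p.1 p.2 + 1) = T - 1 - X.load L s k p.1 p.2 := by omega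
        simp only [hc, if_true, e2, e1, pow_succ]
        ring
      · simp [hc]
    omega
  · have hc : ∀ p : ℕ × ℕ, ¬ X.Covers (s k) p.1 p.2 := fun p hc => hs hc.1
    unfold potential colorSum
    simp [load_succ hk, colorLoad_succ hk, hc]

theorem potential_le (h : X.IsColoring L T pw pq s col) (hk : k ≤ L) :
    X.potential L T s col k ≤ X.n * X.n * (2 ^ T * (8 * T + 8 * T + 1)) := by
  induction k with
  | zero => simp [potential, colorSum, card_grid]
  | succ k ih => exact (h.potential_succ_le hk).trans (ih (by omega))

/-- No point is contained in many boxes of the same colour. -/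
theorem pow_colorLoad_le (h : X.IsColoring L T pw pq s col) {p : ℕ × ℕ} (hp : p ∈ X.grid) {z : ℕ}
    (hz : z < 8 * T + 8 * T + 1) :
    (8 * T + 1) ^ X.colorLoad L s col L p.1 p.2 z ≤
      X.n * X.n * (2 ^ T * (8 * T + 8 * T + 1)) := by
  refine le_trans ?_ (h.potential_le le_rfl)
  have h1 : (8 * T + 1) ^ X.colorLoad L s col L p.1 p.2 z ≤ X.colorSum L T s col L p :=
    Finset.single_le_sum (f := fun z => (8 * T + 1) ^ X.colorLoad L s col L p.1 p.2 z)
      (fun _ _ => Nat.zero_le _) (Finset.mem_range.2 hz)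
  have h2 : 2 ^ (T - X.load L s L p.1 p.2) * X.colorSum L T s col L p ≤
      X.potential L T s col L :=
    Finset.single_le_sum
      (f := fun p => 2 ^ (T - X.load L s L p.1 p.2) * X.colorSum L T s col L p)
      (fun _ _ => Nat.zero_le _) hp
  exact (h1.trans (Nat.le_mul_of_pos_left _ (by positivity))).trans h2

end IsColoring

/-! ### The crossing order and the levels -/

theorem Prec.trans {i j m : ℕ} (h : X.Prec i j) (h' : X.Prec j m) : X.Prec i m :=
  ⟨h'.1.trans h.1, h.2.1.trans h'.2.1, h.2.2.1.trans h'.2.2.1, h'.2.2.2.trans h.2.2.2⟩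

theorem SPrec.trans {i j m : ℕ} (h : X.SPrec i j) (h' : X.SPrec j m) : X.SPrec i m :=
  ⟨h.1.trans h'.1, fun hc => h'.2 (hc.trans h.1)⟩

/-- The boxes that cross a box over one of its points form a chain through a grid point. -/
theorem crossings_lt_colorLoad (hX : X.Valid) (hk : k < L) (hs : s k < X.n) {a : ℕ}
    (h1 : X.l (s k) ≤ X.l a) (h2 : X.l a ≤ X.r (s k)) :
    X.crossings L s col k a < X.colorLoad L s col L a (s k) (col k) := by
  classical
  rw [crossings, colorLoad, clipSum_eq le_rfl]
  refine Finset.sum_lt_sum (fun j _ => ?_) ⟨k, Finset.mem_range.2 hk, ?_⟩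
  · split_ifs with h3 h4 h4
    · exact le_rfl
    · exact absurd ⟨⟨h3.1, h3.2.2.2.1, h3.2.2.2.2, h3.2.2.1.1.2.2.1,
        (hX.b_le_t _ hs).trans h3.2.2.1.1.2.2.2⟩, h3.2.1⟩ h4
    · exact zero_le_one
    · exact le_rfl
  -- Strictness: box `s k` contains the grid point itself but does not cross itself.
  · rw [if_neg fun h3 => h3.2.2.1.2 h3.2.2.1.1,
      if_pos ⟨⟨hs, h1, h2, le_rfl, hX.b_le_t _ hs⟩, rfl⟩]
    exact one_pos

/-- By transitivity, whatever crosses box `s j` over this abscissa also crosses `s k`; in addition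
`s j` counts for `s k`, but not for itself. -/
theorem crossings_lt {j a : ℕ} (hj : j < L) (hs : s j < X.n) (hc : col j = col k)
    (hp : X.SPrec (s j) (s k)) (h1 : X.l (s j) ≤ X.l a) (h2 : X.l a ≤ X.r (s j)) :
    X.crossings L s col j a < X.crossings L s col k a := by
  classical
  refine Finset.sum_lt_sum (fun i _ => ?_) ⟨j, Finset.mem_range.2 hj, ?_⟩
  · split_ifs with h3 h4 h4
    · exact le_rfl
    · exact absurd ⟨h3.1, h3.2.1.trans hc, h3.2.2.1.trans hp, h3.2.2.2⟩ h4
    · exact zero_le_one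
    · exact le_rfl
  · rw [if_neg fun h3 => h3.2.2.1.2 h3.2.2.1.1, if_pos ⟨hs, hc, hp, h1, h2⟩]
    exact one_pos

/-- The level of a box is less than the depth. -/
theorem level_lt (hX : X.Valid) (hlev : ∀ k < L, lev k = X.levelRule L s col k) (hk : k < L)
    (hs : s k < X.n) {D : ℕ}
    (hD : ∀ p ∈ X.grid, X.colorLoad L s col L p.1 p.2 (col k) ≤ D) (hDL : D ≤ L) :
    lev k < D := by
  have h0 : 0 < D := (Nat.zero_le _).trans_lt
    ((crossings_lt_colorLoad hX hk hs le_rfl (hX.l_le_r _ hs)).trans_le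
      (hD (s k, s k) (mem_grid.2 ⟨hs, hs⟩)))
  rw [hlev k hk]
  refine (first_le (x := D - 1) (by omega) fun a _ ha h1 h2 => ?_).trans_lt (by omega)
  have := (crossings_lt_colorLoad (col := col) hX hk hs h1 h2).trans_le
    (hD (a, s k) (mem_grid.2 ⟨ha, hs⟩))
  omega

namespace IsColoring

theorem level_spec (h : X.IsColoring L T pw pq s col) (hX : X.Valid)
    (hlev : ∀ k < L, lev k = X.levelRule L s col k) (hk : k < L) (hs : s k < X.n) {a : ℕ}
    (ha : a < X.n) (h1 : X.l (s k) ≤ X.l a) (h2 : X.l a ≤ X.r (s k)) :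
    X.crossings L s col k a ≤ lev k := by
  have hsp := (first_spec (L := L) (q := fun h => ∀ a < L, a < X.n → X.l (s k) ≤ X.l a →
    X.l a ≤ X.r (s k) → X.crossings L s col k a ≤ h) ⟨T, h.limit_lt, fun a _ ha h1 h2 =>
      (crossings_lt_colorLoad hX hk hs h1 h2).le.trans
        (h.colorLoad_le (p := (a, s k)) le_rfl (mem_grid.2 ⟨ha, hs⟩) _)⟩).2
  rw [hlev k hk]
  exact hsp a (ha.trans_le h.n_le) ha h1 h2

/-- The horizontal projection of `s j` lies in that of `s k`. Over each grid abscissa in it, `s j`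
has fewer crossings than `s k`, hence at most `lev k - 1`. -/
theorem level_lt_of_sPrec (h : X.IsColoring L T pw pq s col) (hX : X.Valid)
    (hlev : ∀ k < L, lev k = X.levelRule L s col k) {j k : ℕ} (hj : j < L) (hk : k < L)
    (hsj : s j < X.n) (hsk : s k < X.n) (hc : col j = col k) (hp : X.SPrec (s j) (s k)) :
    lev j < lev k := by
  have key : ∀ a < X.n, X.l (s j) ≤ X.l a → X.l a ≤ X.r (s j) →
      X.crossings L s col j a < lev k := fun a ha h1 h2 =>
    (crossings_lt hj hsj hc hp h1 h2).trans_le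
      (h.level_spec hX hlev hk hsk ha (hp.1.1.trans h1) (h2.trans hp.1.2.1))
  -- The abscissa of its own left side shows `lev k > 0`, so that subtracting `1` is harmless.
  have h0 := key (s j) hsj le_rfl (hX.l_le_r _ hsj)
  have hL := level_lt hX hlev hk hsk
    (fun p hp => (h.colorLoad_le le_rfl hp _).trans h.limit_lt.le) le_rfl
  rw [hlev j hj]
  refine (first_le (x := lev k - 1) (by omega) fun a _ ha h1 h2 => ?_).trans_lt (by omega)
  have := key a ha h1 h2
  omega

/-- Boxes of the same colour and level are disjoint. -/
theorem not_meets (h : X.IsColoring L T pw pq s col) (hX : X.Valid)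
    (hlev : ∀ k < L, lev k = X.levelRule L s col k) {j k : ℕ} (hjk : j < k) (hk : k < L)
    (hsj : s j < X.n) (hsk : s k < X.n) (hc : col j = col k) (hl : lev j = lev k) :
    ¬ X.Meets (s j) (s k) := by
  intro hm
  have hj := hjk.trans hk
  exact (h.col_spec hk hsk).2.1 j hjk hsj
    ⟨hm, fun hp => (h.level_lt_of_sPrec hX hlev hj hk hsj hsk hc hp).ne hl,
      fun hp => (h.level_lt_of_sPrec hX hlev hk hj hsk hsj hc.symm hp).ne hl.symm⟩ hc

open Classical in
/-- Some class of boxes has its fair share of the weight. -/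
theorem listWeight_le (h : X.IsColoring L T pw pq s col) (hX : X.Valid)
    (hlev : ∀ k < L, lev k = X.levelRule L s col k) {D z h₀ : ℕ}
    (hD : ∀ p ∈ X.grid, ∀ z < 8 * T + 8 * T + 1, X.colorLoad L s col L p.1 p.2 z ≤ D)
    (hDL : D ≤ L) (hz : X.IsHeaviest L s col lev z h₀) :
    X.listWeight s L ≤ (8 * T + 8 * T + 1) * D * X.classWeight L s col lev z h₀ := by
  -- Every listed box has exactly one colour and one level, and these lie in the ranges summed over.
  have key : X.listWeight s L = ∑ y ∈ Finset.range (8 * T + 8 * T + 1), ∑ m ∈ Finset.range D,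
      X.classWeight L s col lev y m := by
    simp only [classWeight, clipSum_eq le_rfl]
    rw [Finset.sum_congr rfl fun y _ => Finset.sum_comm, Finset.sum_comm]
    refine Finset.sum_congr rfl fun k hk => ?_
    rw [Finset.mem_range] at hk
    by_cases hs : s k < X.n
    · have h1 := (h.col_spec hk hs).1
      have h2 := level_lt hX hlev hk hs (fun p hp => hD p hp _ h1) hDL
      simp [hs, ite_and, h1, h2]
    · simp [hs]
  rw [key]
  calc _ ≤ ∑ y ∈ Finset.range (8 * T + 8 * T + 1), ∑ m ∈ Finset.range D,
        X.classWeight L s col lev z h₀ := by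
        refine Finset.sum_le_sum fun y hy => Finset.sum_le_sum fun m hm => ?_
        exact hz y ((Finset.mem_range.1 hy).trans_le h.colors_le) m
          ((Finset.mem_range.1 hm).trans_le hDL)
    _ = _ := by simp; ring

end IsColoring

end BoxData

end RealRAM

/-! ## Running the algorithm -/

namespace RealRAM

/-- A rule for filling an array, together with the arrays it reads. -/
structure Stage where
  target : ℕ
  reads : List ℕ
  rule : State → ℕ → ℕ

namespace Stage

/-- The rule depends only on the arrays it is supposed to read, and on the cells of its own array
that have been filled before. -/
def Local (σ : Stage) : Prop :=
  ∀ (M N : State) (k : ℕ), M.real = N.real → (∀ a ∈ σ.reads, M.nat a = N.nat a) →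
    (∀ j < k, M.nat σ.target j = N.nat σ.target j) → σ.rule M k = σ.rule N k

/-- The array has been filled according to the rule. -/
def Solved (σ : Stage) (M : State) : Prop :=
  ∀ k < M.bound, M.nat σ.target k = σ.rule M k

/-- Carry out several stages. -/
def run : List Stage → State → State
  | [], M => M
  | σ :: l, M => run l (fill σ.target σ.rule M)

theorem run_real (l : List Stage) (M : State) : (run l M).real = M.real := by
  induction l generalizing M with
  | nil => rfl
  | cons σ l ih => rw [run, ih, fill, fillTo_real]

theorem run_nat {l : List Stage} {a : ℕ} (h : ∀ σ ∈ l, a ≠ σ.target) (M : State) :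
    (run l M).nat a = M.nat a := by
  induction l generalizing M with
  | nil => rfl
  | cons σ l ih =>
    rw [run, ih fun σ hσ => h σ (.tail _ hσ), fill, fillTo_nat_of_ne (h σ (.head _))]

theorem run_bound {l : List Stage} (h : ∀ σ ∈ l, 3 ≠ σ.target) (M : State) :
    (run l M).bound = M.bound := by
  rw [State.bound, run_nat h, State.bound]

/-- Later stages do not disturb earlier ones, if they fill other arrays. -/
theorem solved_run {l : List Stage} (hl : ∀ σ ∈ l, σ.Local) (h3 : ∀ σ ∈ l, 3 ≠ σ.target)
    (hp : l.Pairwise fun σ τ => τ.target ∉ σ.target :: σ.reads)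
    (hr : ∀ σ ∈ l, σ.target ∉ σ.reads) (M : State) : ∀ σ ∈ l, σ.Solved (run l M) := by
  induction l generalizing M with
  | nil => simp
  | cons τ l ih =>
    rw [List.pairwise_cons] at hp
    intro σ hσ
    rcases List.mem_cons.1 hσ with rfl | hσ
    · intro k hk
      have hb := run_bound (fun σ hσ => h3 σ (.tail _ hσ)) (fill σ.target σ.rule M)
      have hb' := run_bound h3 M
      rw [hb'] at hk
      have hne : ∀ a ∈ σ.target :: σ.reads, ∀ τ ∈ l, a ≠ τ.target :=
        fun a ha τ hτ heq => hp.1 τ hτ (heq ▸ ha)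
      rw [run, run_nat (hne _ (.head _)), fill_nat hk]
      · refine hl σ (.head _) _ _ _ (by rw [run_real]) (fun a ha => ?_) fun j _ => ?_
        · rw [run_nat (hne a (.tail _ ha))]
        · rw [run_nat (hne _ (.head _))]
      · intro M' M'' h1 h2 h4
        exact hl σ (.head _) _ _ _ h1
          (fun a ha => h2 a fun heq => hr σ (.head _) (heq ▸ ha)) h4
    · exact ih (fun σ hσ => hl σ (.tail _ hσ)) (fun σ hσ => h3 σ (.tail _ hσ)) hp.2
        (fun σ hσ => hr σ (.tail _ hσ)) _ σ hσ

theorem performs_run {l : List Stage} (h : ∀ σ ∈ l, Performs (fill σ.target σ.rule)) :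
    Performs (run l) := by
  induction l with
  | nil => exact ⟨.skip, 1, fun s => ⟨_, _, .skip s, by simp, rfl, rfl⟩⟩
  | cons σ l ih => exact (h σ (.head _)).comp (ih fun σ hσ => h σ (.tail _ hσ))

end Stage

/-! ### Dependence of the rules on the cells filled before -/

theorem clipSum_congr {α : Type*} [AddCommMonoid α] {L m : ℕ} {f g : ℕ → α}
    (h : ∀ x < m, f x = g x) : clipSum L m f = clipSum L m g :=
  Finset.sum_congr rfl fun x _ => by
    split_ifs with hx
    · exact h x hx
    · rfl

namespace BoxData

variable {X : BoxData} {L k : ℕ} {e e' : ℕ → ℕ}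

theorem load_congr (h : ∀ j < k, e j = e' j) (a c : ℕ) :
    X.load L e k a c = X.load L e' k a c :=
  clipSum_congr fun j hj => by rw [h j hj]

theorem pickRule_congr (h : ∀ j < k, e j = e' j) (T : ℕ) (pw : ℕ → ℕ) :
    X.pickRule L T pw e k = X.pickRule L T pw e' k := by
  have h1 : X.load L e k = X.load L e' k :=
    funext fun a => funext fun c => load_congr h a c
  unfold pickRule totalPrice price
  rw [h1]

theorem remains_congr (h : ∀ j < k, e j = e' j) (s : ℕ → ℕ) (u : ℕ) :
    X.Remains L s e k u = X.Remains L s e' k u := by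
  unfold Remains
  refine propext (and_congr_right' ?_)
  refine forall₃_congr fun j _ hj => ?_
  rw [h j hj]

theorem removeRule_congr (h : ∀ j < k, e j = e' j) (Q : ℕ) (s : ℕ → ℕ) :
    X.removeRule L Q s e k = X.removeRule L Q s e' k := by
  have h1 : X.Remains L s e k = X.Remains L s e' k := funext (remains_congr h s)
  unfold removeRule
  rw [h1]

theorem colorRule_congr (h : ∀ j < k, e j = e' j) (T Q : ℕ) (pw pq s : ℕ → ℕ) :
    X.colorRule L T Q pw pq s e k = X.colorRule L T Q pw pq s e' k := by
  have h1 : ∀ a c z, X.colorLoad L s e k a c z = X.colorLoad L s e' k a c z := fun a c z =>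
    clipSum_congr fun j hj => by rw [h j hj]
  have h2 : ∀ z, (∀ j < L, j < k → s j < X.n → X.Conflict (s j) (s k) → e j ≠ z) ↔
      ∀ j < L, j < k → s j < X.n → X.Conflict (s j) (s k) → e' j ≠ z := fun z =>
    forall₃_congr fun j _ hj => by rw [h j hj]
  simp only [colorRule, h1, h2]

end BoxData

/-- The stages of the algorithm. Array `4` receives the powers of two, array `6` the limit `T` on
the depth, array `12` the number `8 * T`, array `7` the powers of `8 * T + 1`, array `5` the boxes
picked, array `8` the order of removal, array `9` the reversed list, arrays `10` and `11` the
colours and levels, arrays `13` and `14` colour and level of the heaviest class. -/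
noncomputable def stages : List Stage :=
  -- Powers without multiplication: `2 ^ k` is one more than the sum of the smaller powers.
  [⟨4, [3], fun M k => 1 + clipSum M.bound k (M.nat 4)⟩,
   ⟨6, [0, 3, 4], fun M _ =>
      first M.bound (fun m => M.boxes.n ≤ M.nat 4 m)
        + first M.bound (fun m => M.boxes.n ≤ M.nat 4 m)
        + first M.bound (fun m => M.boxes.n ≤ M.nat 4 m)
        + first M.bound (fun m => M.boxes.n ≤ M.nat 4 m)⟩,
   ⟨12, [6], fun M _ => M.nat 6 0 + M.nat 6 0 + M.nat 6 0 + M.nat 6 0 + M.nat 6 0 + M.nat 6 0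
      + M.nat 6 0 + M.nat 6 0⟩,
   -- With `q = 8 * T`, the geometric sum `1 + ∑ j < k, q * (q + 1) ^ j` equals `(q + 1) ^ k`.
   ⟨7, [3, 12], fun M k =>
      1 + clipSum M.bound k fun j => clipSum M.bound (M.nat 12 0) fun _ => M.nat 7 j⟩,
   ⟨5, [0, 3, 4, 6], fun M k => M.boxes.pickRule M.bound (M.nat 6 0) (M.nat 4) (M.nat 5) k⟩,
   ⟨8, [0, 3, 5, 12], fun M k =>
      M.boxes.removeRule M.bound (M.nat 12 0) (M.nat 5) (M.nat 8) k⟩,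
   ⟨9, [0, 3, 5, 8], fun M k => M.boxes.reverseRule M.bound (M.nat 5) (M.nat 8) k⟩,
   ⟨10, [0, 3, 4, 6, 7, 9, 12], fun M k => M.boxes.colorRule M.bound (M.nat 6 0) (M.nat 12 0)
      (M.nat 4) (M.nat 7) (M.nat 9) (M.nat 10) k⟩,
   ⟨11, [0, 3, 9, 10], fun M k => M.boxes.levelRule M.bound (M.nat 9) (M.nat 10) k⟩,
   ⟨13, [0, 3, 9, 10, 11], fun M _ => first M.bound fun z => ∃ h < M.bound,
      M.boxes.IsHeaviest M.bound (M.nat 9) (M.nat 10) (M.nat 11) z h⟩,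
   ⟨14, [0, 3, 9, 10, 11, 13], fun M _ => first M.bound fun h =>
      M.boxes.IsHeaviest M.bound (M.nat 9) (M.nat 10) (M.nat 11) (M.nat 13 0) h⟩,
   ⟨1, [0, 3, 9, 10, 11, 13, 14], fun M k => M.boxes.selectRule M.bound (M.nat 9) (M.nat 10)
      (M.nat 11) (M.nat 13 0) (M.nat 14 0) k⟩]

theorem performs_stages : Performs (Stage.run stages) := by
  have cell : ∀ {d : ℕ} (a : ℕ), a ≠ 2 → NatComputable (d := d) fun M _ => M.nat a 0 :=
    fun a ha => .get a ha (.lit 0)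
  have hfirst : NatComputable (d := 1) fun M _ =>
      first M.bound (fun m => M.boxes.n ≤ M.nat 4 m) :=
    .first (.le natComputable_n (.get 4 (by decide) (.var _)))
  have h6 := cell (d := 1) 6 (by decide)
  apply Stage.performs_run
  simp only [stages, List.forall_mem_cons]
  refine ⟨?_, ?_, ?_, ?_, ?_, ?_, ?_, ?_, ?_, ?_, ?_, ?_, by simp⟩ <;>
    refine performs_fill (by decide) (by decide) ?_
  · exact (NatComputable.lit 1).add (.clipSum (.var 0) (.get 4 (by decide) (.var _)))
  · exact ((hfirst.add hfirst).add hfirst).add hfirst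
  · exact ((((((h6.add h6).add h6).add h6).add h6).add h6).add h6).add h6
  · exact (NatComputable.lit 1).add (.clipSum (.var 0) (.clipSum (cell 12 (by decide))
      (.get 7 (by decide) (.var _))))
  · exact natComputable_pickRule (by decide) (by decide) (.var 0) (cell 6 (by decide))
  · exact natComputable_removeRule (by decide) (by decide) (.var 0) (cell 12 (by decide))
  · exact natComputable_reverseRule (by decide) (by decide) (.var 0)
  · exact natComputable_colorRule (by decide) (by decide) (by decide) (by decide) (.var 0)
      (cell 6 (by decide)) (cell 12 (by decide))
  · exact natComputable_levelRule (by decide) (by decide) (.var 0)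
  · exact .first (.ex (decides_isHeaviest (by decide) (by decide) (by decide) (.var _) (.var _)))
  · exact .first (decides_isHeaviest (by decide) (by decide) (by decide) (cell 13 (by decide))
      (.var _))
  · exact natComputable_selectRule (by decide) (by decide) (by decide) (cell 13 (by decide))
      (cell 14 (by decide)) (.var 0)

theorem State.boxes_congr {M M' : State} (h : M.real = M'.real) (h' : M.nat 0 = M'.nat 0) :
    M.boxes = M'.boxes := by
  simp only [State.boxes, h, h']

theorem State.bound_congr {M M' : State} (h : M.nat 3 = M'.nat 3) : M.bound = M'.bound := by
  simp only [State.bound, h]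

theorem solved_stages (M : State) : ∀ σ ∈ stages, σ.Solved (Stage.run stages M) := by
  refine Stage.solved_run ?_ (by simp [stages]) (by simp [stages]) (by simp [stages]) M
  simp only [stages, List.forall_mem_cons]
  refine ⟨?_, ?_, ?_, ?_, ?_, ?_, ?_, ?_, ?_, ?_, ?_, ?_, by simp⟩ <;>
    intro M M' k hr hn hj <;>
    simp only [List.forall_mem_cons, List.not_mem_nil, false_imp_iff, implies_true, and_true]
      at hn hj ⊢
  · rw [State.bound_congr hn, clipSum_congr hj]
  · obtain ⟨h0, h3, h4⟩ := hn
    rw [State.bound_congr h3, State.boxes_congr hr h0, h4]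
  · rw [hn]
  · obtain ⟨h3, h12⟩ := hn
    rw [State.bound_congr h3, h12, clipSum_congr fun j hjk => by rw [hj j hjk]]
  · obtain ⟨h0, h3, h4, h6⟩ := hn
    rw [State.bound_congr h3, State.boxes_congr hr h0, h4, h6, BoxData.pickRule_congr hj]
  · obtain ⟨h0, h3, h5, h12⟩ := hn
    rw [State.bound_congr h3, State.boxes_congr hr h0, h5, h12, BoxData.removeRule_congr hj]
  · obtain ⟨h0, h3, h5, h8⟩ := hn
    rw [State.bound_congr h3, State.boxes_congr hr h0, h5, h8]
  · obtain ⟨h0, h3, h4, h6, h7, h9, h12⟩ := hn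
    rw [State.bound_congr h3, State.boxes_congr hr h0, h4, h6, h7, h9, h12,
      BoxData.colorRule_congr hj]
  · obtain ⟨h0, h3, h9, h10⟩ := hn
    rw [State.bound_congr h3, State.boxes_congr hr h0, h9, h10]
  · obtain ⟨h0, h3, h9, h10, h11⟩ := hn
    rw [State.bound_congr h3, State.boxes_congr hr h0, h9, h10, h11]
  · obtain ⟨h0, h3, h9, h10, h11, h13⟩ := hn
    rw [State.bound_congr h3, State.boxes_congr hr h0, h9, h10, h11, h13]
  · obtain ⟨h0, h3, h9, h10, h11, h13, h14⟩ := hn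
    rw [State.bound_congr h3, State.boxes_congr hr h0, h9, h10, h11, h13, h14]

end RealRAM

/-! ## The approximation guarantee -/

namespace RealRAM

/-- If a class receives its share of the weight, it has a fraction of order `log log n / log n`
of the optimum. -/
theorem ratio_le {n ℓ D : ℕ} {O W : ℝ} (hn : 3 ≤ n) (h1 : n ≤ 2 ^ ℓ) (h2 : 2 ^ ℓ ≤ 2 * n + 1)
    (h3 : ℓ ≤ n)
    (hD : (32 * ℓ + 1) ^ D ≤ n * n * (2 ^ (4 * ℓ) * (64 * ℓ + 1))) (hW : 0 ≤ W)
    (h : ℓ * O ≤ (64 * ℓ + 1) * D * W) :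
    1 / 975 * (Real.log (Real.log n) / Real.log n) * O ≤ W := by
  have hℓ : 1 ≤ ℓ := by
    by_contra hc
    obtain rfl : ℓ = 0 := by omega
    simp at h1; omega
  have hnR : (3 : ℝ) ≤ n := by exact_mod_cast hn
  have hℓR : (1 : ℝ) ≤ ℓ := by exact_mod_cast hℓ
  have hlog : 1 < Real.log n := by
    rw [Real.lt_log_iff_exp_lt (by linarith)]
    have := Real.exp_one_lt_d9
    linarith
  have hll : 0 ≤ Real.log (Real.log n) := Real.log_nonneg hlog.le
  -- From `2 ^ ℓ ≤ 3 * n` and `ℓ ≤ n` the bound is at most `5265 * n ^ 7`, and `5265 ≤ 3 ^ 8 ≤ n ^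
  -- 8`.
  have hpow : (32 * ℓ + 1) ^ D ≤ n ^ 15 := by
    refine hD.trans ?_
    have e1 : 2 ^ (4 * ℓ) ≤ (3 * n) ^ 4 := by
      rw [mul_comm, pow_mul]
      exact Nat.pow_le_pow_left (by omega) 4
    have e2 : 64 * ℓ + 1 ≤ 65 * n := by omega
    have e3 : 3 ^ 8 ≤ n ^ 8 := Nat.pow_le_pow_left hn 8
    calc n * n * (2 ^ (4 * ℓ) * (64 * ℓ + 1)) ≤ n * n * ((3 * n) ^ 4 * (65 * n)) := by gcongr
      _ = 5265 * n ^ 7 := by ring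
      _ ≤ n ^ 8 * n ^ 7 := Nat.mul_le_mul_right _ (le_trans (by norm_num) e3)
      _ = n ^ 15 := by ring
  -- Since `log n ≤ 32 * ℓ + 1`, taking logarithms in `hpow` bounds `D * log (log n)`.
  have hDlog : D * Real.log (Real.log n) ≤ 15 * Real.log n := by
    have e1 : Real.log n ≤ 32 * ℓ + 1 := by
      have : Real.log n ≤ Real.log (2 ^ ℓ) :=
        Real.log_le_log (by linarith) (by exact_mod_cast h1)
      rw [Real.log_pow] at this
      have := Real.log_two_lt_d9
      nlinarith
    have e2 : Real.log (Real.log n) ≤ Real.log (32 * ℓ + 1) :=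
      Real.log_le_log (by linarith) e1
    have e3 : D * Real.log (32 * ℓ + 1) ≤ 15 * Real.log n := by
      have : Real.log ((32 * ℓ + 1) ^ D) ≤ Real.log (n ^ 15) :=
        Real.log_le_log (by positivity) (by exact_mod_cast hpow)
      rw [Real.log_pow, Real.log_pow] at this
      exact_mod_cast this
    exact (mul_le_mul_of_nonneg_left e2 (Nat.cast_nonneg D)).trans e3
  -- As `64 * ℓ + 1 ≤ 65 * ℓ`, the factor `ℓ` cancels. The final constant is `975 = 65 * 15`.
  have hO' : O ≤ 65 * D * W := by
    have hDW : 0 ≤ D * W := by positivity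
    have : ℓ * O ≤ ℓ * (65 * D * W) := h.trans (by nlinarith)
    exact le_of_mul_le_mul_left this (by linarith)
  rw [mul_div_assoc', div_mul_eq_mul_div, div_le_iff₀ (by linarith)]
  calc 1 / 975 * Real.log (Real.log n) * O
      ≤ 1 / 975 * Real.log (Real.log n) * (65 * D * W) := by gcongr
    _ = 1 / 15 * (D * Real.log (Real.log n)) * W := by ring
    _ ≤ 1 / 15 * (15 * Real.log n) * W := by gcongr
    _ = W * Real.log n := by ring

/-- The number of doublings needed to reach `n`. -/
theorem first_two_pow {n L : ℕ} (hL : n < L) {pw : ℕ → ℕ} (hpw : ∀ k < L, pw k = 2 ^ k) {ℓ : ℕ}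
    (hℓ : ℓ = first L fun m => n ≤ pw m) : n ≤ 2 ^ ℓ ∧ 2 ^ ℓ ≤ 2 * n + 1 ∧ ℓ ≤ n := by
  have hq : n ≤ pw n := by rw [hpw n hL]; exact n.lt_two_pow_self.le
  have hle : ℓ ≤ n := hℓ ▸ first_le hL hq
  obtain ⟨h1, h2⟩ := first_spec (L := L) (q := fun m => n ≤ pw m) ⟨n, hL, hq⟩
  rw [← hℓ] at h1 h2
  rw [hpw ℓ h1] at h2
  refine ⟨h2, ?_, hle⟩
  rcases Nat.eq_zero_or_pos ℓ with h0 | h0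
  · simp [h0]
  · have : ¬ n ≤ pw (ℓ - 1) := fun hc => by
      have := first_le (L := L) (q := fun m => n ≤ pw m) (x := ℓ - 1) (by omega) hc
      omega
    rw [hpw _ (by omega)] at this
    have e : 2 ^ ℓ = 2 * 2 ^ (ℓ - 1) := by rw [← pow_succ']; congr 1; omega
    omega

/-- Consecutive equations differ by `q * pw k`, so `pw (k + 1) = (q + 1) * pw k`. This serves for
the powers of `2` and of `8 * T + 1` alike. -/
theorem eq_pow_of_geom {L q : ℕ} {pw : ℕ → ℕ} (hq : q ≤ L)
    (h : ∀ k < L, pw k = 1 + clipSum L k fun j => clipSum L q fun _ => pw j) :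
    ∀ k < L, pw k = (q + 1) ^ k := by
  intro k
  induction k with
  | zero => intro hk; rw [h 0 hk]; simp [clipSum]
  | succ k ih =>
    intro hk
    have hk' : k < L := by omega
    have e := h k hk'
    rw [clipSum_eq hk'.le] at e
    rw [h _ hk, clipSum_eq hk.le, Finset.sum_range_succ, ← add_assoc, ← e, clipSum_const hq,
      ih hk', pow_succ]
    ring

/-- What the algorithm has computed in the end. -/
theorem exists_class (M : State) (hX : M.boxes.Valid)
    (hb : M.bound = (M.boxes.n + 2) ^ 8) (hM : ∀ σ ∈ stages, σ.Solved M) :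
    ∃ F : Finset ℕ, (∀ i, i < M.boxes.n → (M.nat 1 i ≠ 0 ↔ ∃ j ∈ F, M.nat 9 j = i)) ∧
      (∀ j ∈ F, M.nat 9 j < M.boxes.n) ∧
      (∀ j ∈ F, ∀ k ∈ F, j ≠ k → ¬ M.boxes.Meets (M.nat 9 j) (M.nat 9 k)) ∧
      (3 ≤ M.boxes.n → ∀ J : Finset ℕ, (∀ i ∈ J, i < M.boxes.n) →
        (∀ i ∈ J, ∀ j ∈ J, i ≠ j → ∀ a c, ¬ (M.boxes.Covers i a c ∧ M.boxes.Covers j a c)) →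
        1 / 975 * (Real.log (Real.log M.boxes.n) / Real.log M.boxes.n) *
          ∑ i ∈ J, M.boxes.w i ≤ ∑ j ∈ F, M.boxes.w (M.nat 9 j)) := by
  classical
  simp only [stages, List.forall_mem_cons, Stage.Solved] at hM
  obtain ⟨m4, m6, m12, m7, m5, m8, m9, m10, m11, m13, m14, m1, -⟩ := hM
  set X := M.boxes with hXdef
  set L := M.bound with hL
  have hbig : X.n + 2 ≤ L := hb ▸ Nat.le_self_pow (by norm_num) _
  have h0 : 0 < L := by omega
  have p4 : ∀ k < L, M.nat 4 k = 2 ^ k := by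
    refine eq_pow_of_geom (by omega) fun k hk => ?_
    rw [m4 k hk]
    congr 1
    exact clipSum_congr fun j _ => by rw [clipSum_const (by omega), one_mul]
  obtain ⟨ℓ, hℓ⟩ : ∃ ℓ, ℓ = first L fun m => X.n ≤ M.nat 4 m := ⟨_, rfl⟩
  obtain ⟨hℓ1, hℓ2, hℓ3⟩ := first_two_pow (by omega) p4 hℓ
  have hT : M.nat 6 0 = 4 * ℓ := by rw [m6 0 h0, ← hℓ]; ring
  have hQ : M.nat 12 0 = 8 * (4 * ℓ) := by rw [m12 0 h0, hT]; ring
  -- Here `2 ^ ℓ ≤ 2 * n + 1 ≤ (n + 2) ^ 2`; this is the reason for the exponent `8` of the loop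
  -- bound.
  have hlim : 2 ^ (4 * ℓ) ≤ L := by
    rw [hb, mul_comm, pow_mul, show (X.n + 2) ^ 8 = ((X.n + 2) ^ 2) ^ 4 by rw [← pow_mul]]
    exact Nat.pow_le_pow_left (by nlinarith) 4
  have hcol : 8 * (4 * ℓ) + 8 * (4 * ℓ) + 1 ≤ L := by
    have e1 : 2 ^ 7 ≤ (X.n + 2) ^ 7 := Nat.pow_le_pow_left (by omega) 7
    rw [hb, pow_succ]
    nlinarith
  have p7 : ∀ k < L, M.nat 7 k = (8 * (4 * ℓ) + 1) ^ k :=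
    eq_pow_of_geom (by omega) fun k hk => by rw [m7 k hk, hQ]
  rw [hT] at m5 m10
  rw [hQ] at m8 m10
  have greedy : X.IsGreedy L (4 * ℓ) (M.nat 4) (M.nat 5) := ⟨hX, by omega, hlim, p4, m5⟩
  have removal : X.IsRemoval L (4 * ℓ) (M.nat 5) (M.nat 8) := ⟨greedy.load_le le_rfl, m8⟩
  have coloring : X.IsColoring L (4 * ℓ) (M.nat 4) (M.nat 7) (M.nat 9) (M.nat 10) :=
    ⟨by omega, hlim, hcol, p4, p7,
      fun p hp => by rw [removal.load_reverse m9]; exact greedy.load_le le_rfl p hp,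
      fun k hk hs V hV hVc => le_trans (Finset.card_le_card fun j hj =>
        Finset.mem_filter.2 ⟨hV hj, hVc j hj⟩) (removal.card_conflict_reverse_le m9 hk hs), m10⟩
  -- A maximal pair exists among finitely many, so the search for its colour and then that for a
  -- matching level both succeed.
  have heavy : X.IsHeaviest L (M.nat 9) (M.nat 10) (M.nat 11) (M.nat 13 0) (M.nat 14 0) := by
    obtain ⟨q, hq, hmax⟩ := Finset.exists_max_image (Finset.range L ×ˢ Finset.range L)
      (fun q => X.classWeight L (M.nat 9) (M.nat 10) (M.nat 11) q.1 q.2)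
      ⟨(0, 0), by simp [h0]⟩
    rw [Finset.mem_product, Finset.mem_range, Finset.mem_range] at hq
    have hz := (first_spec (L := L) (q := fun z => ∃ h < L,
      X.IsHeaviest L (M.nat 9) (M.nat 10) (M.nat 11) z h) ⟨q.1, hq.1, q.2, hq.2,
        fun z hz h hh => hmax (z, h) (by simp [hz, hh])⟩).2
    rw [← m13 0 h0] at hz
    have hh := (first_spec hz).2
    rwa [← m14 0 h0] at hh
  set F := (Finset.range L).filter fun j => M.nat 9 j < X.n ∧ M.nat 10 j = M.nat 13 0 ∧
    M.nat 11 j = M.nat 14 0 with hF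
  have hFw : X.classWeight L (M.nat 9) (M.nat 10) (M.nat 11) (M.nat 13 0) (M.nat 14 0) =
      ∑ j ∈ F, X.w (M.nat 9 j) := by
    rw [BoxData.classWeight, clipSum_eq le_rfl, hF, Finset.sum_filter]
  have memF : ∀ {j}, j ∈ F ↔ j < L ∧ M.nat 9 j < X.n ∧ M.nat 10 j = M.nat 13 0 ∧
      M.nat 11 j = M.nat 14 0 := by simp [hF]
  have disj : ∀ j ∈ F, ∀ k ∈ F, j < k → ¬ X.Meets (M.nat 9 j) (M.nat 9 k) := by
    intro j hj k hk hjk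
    rw [memF] at hj hk
    exact coloring.not_meets hX m11 hjk hk.1 hj.2.1 hk.2.1 (hj.2.2.1.trans hk.2.2.1.symm)
      (hj.2.2.2.trans hk.2.2.2.symm)
  refine ⟨F, fun i hi => ?_, fun j hj => (memF.1 hj).2.1, fun j hj k hk hjk hm => ?_,
    fun hn J hJn hJ => ?_⟩
  · rw [m1 i (by omega), BoxData.selectRule]
    simp only [memF, ne_eq, ite_eq_right_iff, one_ne_zero, imp_false, not_not]
    exact ⟨fun ⟨j, h1, h2, h3⟩ => ⟨j, ⟨h1, h3⟩, h2⟩, fun ⟨j, ⟨h1, h3⟩, h2⟩ => ⟨j, h1, h2, h3⟩⟩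
  · rcases lt_or_gt_of_ne hjk with hlt | hgt
    · exact disj j hj k hk hlt hm
    · exact disj k hk j hj hgt ⟨hm.2.1, hm.1, hm.2.2.2, hm.2.2.1⟩
  -- The depth `D` is the largest colour load. As it is attained, the potential bound applies to `D`
  -- itself.
  · obtain ⟨q, hq, hmax⟩ := Finset.exists_max_image
      (X.grid ×ˢ Finset.range (8 * (4 * ℓ) + 8 * (4 * ℓ) + 1))
      (fun q => X.colorLoad L (M.nat 9) (M.nat 10) L q.1.1 q.1.2 q.2)
      ⟨((0, 0), 0), Finset.mem_product.2 ⟨BoxData.mem_grid.2 (by simp only; omega), by simp⟩⟩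
    rw [Finset.mem_product, Finset.mem_range] at hq
    have hD := coloring.pow_colorLoad_le hq.1 hq.2
    have hDL := (coloring.colorLoad_le le_rfl hq.1 q.2).trans coloring.limit_lt.le
    have hW := coloring.listWeight_le hX m11
      (fun p hp z hz => hmax (p, z) (Finset.mem_product.2 ⟨hp, Finset.mem_range.2 hz⟩)) hDL heavy
    rw [removal.listWeight_reverse m9, hFw] at hW
    have hO := (greedy.le_listWeight hℓ1 hJn hJ).trans hW
    refine ratio_le (D := X.colorLoad L (M.nat 9) (M.nat 10) L q.1.1 q.1.2 q.2) hn hℓ1 hℓ2 hℓ3 ?_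
      (Finset.sum_nonneg fun j hj => (hX.w_pos _ (memF.1 hj).2.1).le) (hO.trans_eq ?_)
    · convert hD using 3 <;> ring
    · push_cast; ring

/-- The boxes of the input. -/
theorem input_boxes {n : ℕ} (B : Fin n → WeightedBox) {M : State}
    (h0 : M.nat 0 0 = n) (hr : M.real = (input B).real) :
    M.boxes.n = n ∧ ∀ i : Fin n, M.boxes.l i = (B i).left ∧ M.boxes.r i = (B i).right ∧
      M.boxes.b i = (B i).bottom ∧ M.boxes.t i = (B i).top ∧ M.boxes.w i = (B i).weight := by
  refine ⟨h0, fun i => ?_⟩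
  simp [State.boxes, hr, input]

end RealRAM

/-! ### From the final memory to the input boxes -/

theorem mainTheorem7 :
    ∃ (P : RealRAM.Program) (p : Polynomial ℕ) (c : ℝ), 0 < c ∧
      ∀ (n : ℕ) (B : Fin n → WeightedBox),
        ∃ (t : ℕ) (s : RealRAM.State),
          RealRAM.Exec P (RealRAM.input B) t s ∧
          t ≤ p.eval n ∧
          WeightedBox.IsIndependent B (RealRAM.output n s) ∧
          (3 ≤ n →
            c * (Real.log (Real.log n) / Real.log n) * WeightedBox.opt B ≤
              WeightedBox.totalWeight B (RealRAM.output n s)) := by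
  classical
  obtain ⟨P, p, hP⟩ := RealRAM.performs_stages.exec_input 8
  refine ⟨P, p, 1 / 975, by norm_num, fun n B => ?_⟩
  obtain ⟨t, s, hx, ht, hs⟩ := hP n B
  set M₀ := (RealRAM.input B).writeNat 3 0 ((n + 2) ^ 8) with hM₀
  have hM := RealRAM.solved_stages M₀
  rw [← hs] at hM
  have h00 : s.clean.nat 0 0 = n := by
    rw [hs, RealRAM.Stage.run_nat (by simp [RealRAM.stages])]
    simp [M₀, RealRAM.input]
  have hreal : s.clean.real = (RealRAM.input B).real := by
    rw [hs, RealRAM.Stage.run_real]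
    rfl
  have hbound : s.clean.bound = (n + 2) ^ 8 := by
    rw [hs, RealRAM.Stage.run_bound (by simp [RealRAM.stages])]
    simp [M₀, RealRAM.State.bound]
  obtain ⟨hXn, hXB⟩ := RealRAM.input_boxes B h00 hreal
  have hvalid : s.clean.boxes.Valid := by
    constructor <;> intro i hi <;> rw [hXn] at hi <;>
      obtain ⟨h1, h2, h3, h4, h5⟩ := hXB ⟨i, hi⟩ <;> simp only at h1 h2 h3 h4 h5
    · rw [h1, h2]; exact (B ⟨i, hi⟩).left_le_right
    · rw [h3, h4]; exact (B ⟨i, hi⟩).bottom_le_top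
    · rw [h5]; exact (B ⟨i, hi⟩).weight_pos
  obtain ⟨F, hF1, hF2, hF3, hF4⟩ :=
    RealRAM.exists_class s.clean hvalid (by rw [hbound, hXn]) hM
  rw [hXn] at hF1 hF2 hF4
  have hmem : ∀ i : Fin n, i ∈ RealRAM.output n s ↔ ∃ j ∈ F, s.clean.nat 9 j = i := by
    intro i
    rw [← hF1 i i.2, s.clean_nat (by decide)]
    simp [RealRAM.output]
  have hmeets : ∀ i j : Fin n, ∀ q, q ∈ (B i).region → q ∈ (B j).region →
      s.clean.boxes.Meets i j := by
    intro i j q ⟨⟨a1, a2⟩, a3, a4⟩ ⟨⟨b1, b2⟩, b3, b4⟩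
    obtain ⟨h1, h2, h3, h4, -⟩ := hXB i
    obtain ⟨g1, g2, g3, g4, -⟩ := hXB j
    exact ⟨h1 ▸ g2 ▸ a1.trans b2, g1 ▸ h2 ▸ b1.trans a2, h3 ▸ g4 ▸ a3.trans b4,
      g3 ▸ h4 ▸ b3.trans a4⟩
  refine ⟨t, s, hx, ht, ?_, fun hn => ?_⟩
  · intro i hi j hj hij
    obtain ⟨u, hu, hui⟩ := (hmem i).1 hi
    obtain ⟨v, hv, hvj⟩ := (hmem j).1 hj
    rw [Set.eq_empty_iff_forall_notMem]
    rintro q ⟨hqi, hqj⟩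
    refine hF3 u hu v hv (fun huv => hij (Fin.ext ?_)) ?_
    · rw [← hui, ← hvj, huv]
    · rw [hui, hvj]; exact hmeets i j q hqi hqj
  · obtain ⟨⟨J, hJ, hJo⟩, -⟩ := WeightedBox.isGreatest_opt B
    have hsum := hF4 hn (J.map Fin.valEmbedding) (by simp) (by
      simp only [Finset.mem_map, Fin.valEmbedding_apply]
      rintro _ ⟨i, hi, rfl⟩ _ ⟨j, hj, rfl⟩ hij a c ⟨hi', hj'⟩
      have hd := hJ i hi j hj fun h => hij (by rw [h])
      obtain ⟨h1, h2, h3, h4, -⟩ := hXB i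
      obtain ⟨g1, g2, g3, g4, -⟩ := hXB j
      obtain ⟨-, a1, a2, a3, a4⟩ := hi'
      obtain ⟨-, b1, b2, b3, b4⟩ := hj'
      rw [h1] at a1; rw [h2] at a2; rw [h3] at a3; rw [h4] at a4
      rw [g1] at b1; rw [g2] at b2; rw [g3] at b3; rw [g4] at b4
      -- A grid point covered by both boxes would be a common point of their regions.
      exact Set.eq_empty_iff_forall_notMem.1 hd (s.clean.boxes.l a, s.clean.boxes.b c)
        ⟨⟨⟨a1, a2⟩, a3, a4⟩, ⟨b1, b2⟩, b3, b4⟩)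
    have e1 : ∑ i ∈ J.map Fin.valEmbedding, s.clean.boxes.w i = WeightedBox.opt B := by
      rw [← hJo, WeightedBox.totalWeight, Finset.sum_map]
      exact Finset.sum_congr rfl fun i _ => (hXB i).2.2.2.2
    -- A box listed twice in the class would meet itself, so the weight of the class counts no box
    -- twice.
    have hinj : Set.InjOn (s.clean.nat 9) F := by
      intro j hj k hk hjk
      by_contra hne
      refine hF3 j hj k hk hne ?_
      have hlt := hF2 k hk
      rw [← hXn] at hlt
      rw [hjk]
      exact ⟨hvalid.l_le_r _ hlt, hvalid.l_le_r _ hlt, hvalid.b_le_t _ hlt,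
        hvalid.b_le_t _ hlt⟩
    have e2 : ∑ j ∈ F, s.clean.boxes.w (s.clean.nat 9 j) =
        WeightedBox.totalWeight B (RealRAM.output n s) := by
      have e3 : F.image (s.clean.nat 9) = (RealRAM.output n s).map Fin.valEmbedding := by
        ext i
        simp only [Finset.mem_image, Finset.mem_map, Fin.valEmbedding_apply]
        constructor
        · rintro ⟨j, hj, rfl⟩
          exact ⟨⟨_, hF2 j hj⟩, (hmem _).2 ⟨j, hj, rfl⟩, rfl⟩
        · rintro ⟨i, hi, rfl⟩
          exact (hmem i).1 hi
      rw [← Finset.sum_image (f := s.clean.boxes.w) hinj, e3, Finset.sum_map,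
        WeightedBox.totalWeight]
      exact Finset.sum_congr rfl fun i _ => (hXB i).2.2.2.2
    rw [e1, e2] at hsum
    exact hsum
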